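/- Let $a,b>0$ and let $\xi\in(0,1)$ be irrational. Let $\mathcal H=[H^2(0,1)\cap H^1_0(0,1)]\times L^2(0,1)$ (complex-valued functions) with inner product $(U_1,U_2)_{\mathcal H}=\int_0^1\big(a\,u_1''\,\overline{u_2''}+v_1\overline{v_2}\big)\,dx$ for $U_i=(u_i,v_i)$. For $\alpha\ge 0$ let $\mathcal A=\mathcal A_\alpha$ be the unbounded operator in $\mathcal H$ whose domain $D(\mathcal A_\alpha)$ consists of all $(u,v)\in\mathcal H$ with $u\in H^4(0,\xi)\cap H^4(\xi,1)\cap H^2(0,1)$, $v\in H^2(0,1)$, and $$u(0)=v(0)=u(1)=v(1)=0,\quad u''(0)=u''(1)=0,\quad u''(\xi^-)=u''(\xi^+),\quad u'''(\xi^+)-u'''(\xi^-)=-\frac{\alpha}{a}\,v(\xi),$$ and which is given by $\mathcal A_\alpha(u,v)=\big(v,\,-a\,u''''-b\,v-\alpha\,v(\xi)\,\delta_\xi\big)$ in the sense of distributions on $(0,1)$; equivalently, the second component is the $L^2$ function $-a\,u''''-b\,v$ with $u''''$ taken on $(0,\xi)$ and on $(\xi,1)$ separately. Then: (1) For $\alpha=0$,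 the spectrum $\sigma(\mathcal A_0)$ satisfies $$\sup_{\mu\in\sigma(\mathcal A_0)}\operatorname{Re}\mu=\omega,\qquad \omega:=\begin{cases}-\dfrac b2 & \text{if } b\le 2\sqrt a\,\pi^2,\\[2mm] \dfrac12\left(-b+\sqrt{b^2-4a\pi^4}\right) & \text{if } b>2\sqrt a\,\pi^2.\end{cases}$$ (2) For every $\varepsilon>0$ there exists $\alpha_0>0$ such that for every $\alpha$ with $0<\alpha<\alpha_0$ every eigenvalue $\mu$ of $\mathcal A_\alpha$ satisfies $\operatorname{Re}\mu\le\omega+\varepsilon$. -/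

import Mathlib

open MeasureTheory Set
open scoped ContDiff

/-- `w` is the weak derivative of order `k` of `u` on the open set `Ω ⊆ ℝ`. -/
structure HasWeakDeriv (Ω : Set ℝ) (k : ℕ) (u w : ℝ → ℂ) : Prop where
  locInt : LocallyIntegrableOn u Ω
  locInt' : LocallyIntegrableOn w Ω
  integral_eq : ∀ φ : ℝ → ℝ, ContDiff ℝ ∞ φ → HasCompactSupport φ → tsupport φ ⊆ Ω →
    ∫ x in Ω, iteratedDeriv k φ x • u x = (-1 : ℂ) ^ k * ∫ x in Ω, φ x • w x

/-- `u` belongs to the complex Sobolev space `H^k(Ω)`: for every `j ≤ k` the weak derivative of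
order `j` of `u` exists and lies in `L²(Ω)` (for `j = 0` this says `u ∈ L²(Ω)`). -/
def MemHk (Ω : Set ℝ) (k : ℕ) (u : ℝ → ℂ) : Prop :=
  ∀ j ≤ k, ∃ w : ℝ → ℂ, MemLp w 2 (volume.restrict Ω) ∧ HasWeakDeriv Ω j u w

/-- The weak derivative of order `j` of `u` on `(c, d)` has a representative that is continuous
on `[c, d]` and takes the value `y` at `x`.  For `x = c` or `x = d` this is the one-sided value
`u^{(j)}(c⁺) = y`, respectively `u^{(j)}(d⁻) = y`; for `j = 0` it concerns `u` itself. -/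
def HasTrace (c d : ℝ) (j : ℕ) (u : ℝ → ℂ) (x : ℝ) (y : ℂ) : Prop :=
  ∃ g : ℝ → ℂ, ContinuousOn g (Icc c d) ∧ HasWeakDeriv (Ioo c d) j u g ∧ g x = y

theorem hasWeakDeriv_zero (Ω : Set ℝ) (k : ℕ) :
    HasWeakDeriv Ω k (fun _ => (0 : ℂ)) (fun _ => (0 : ℂ)) where
  locInt := (integrableOn_zero).locallyIntegrableOn
  locInt' := (integrableOn_zero).locallyIntegrableOn
  integral_eq := by intro φ _ _ _; simp

theorem HasWeakDeriv.smul {Ω : Set ℝ} {k : ℕ} {u w : ℝ → ℂ} (c : ℂ)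
    (h : HasWeakDeriv Ω k u w) :
    HasWeakDeriv Ω k (fun x => c * u x) (fun x => c * w x) where
  locInt := fun x hx => (h.locInt x hx).smul c
  locInt' := fun x hx => (h.locInt' x hx).smul c
  integral_eq := by
    intro φ h1 h2 h3
    have e := h.integral_eq φ h1 h2 h3
    have e1 : ∀ (f : ℝ → ℝ) (g : ℝ → ℂ),
        ∫ x in Ω, f x • (c * g x) = c * ∫ x in Ω, f x • g x := by
      intro f g
      rw [← integral_const_mul]
      congr 1
      funext x
      simp only [Complex.real_smul]
      ring
    rw [e1, e1, e]
    ring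

/-- A continuous function with compact support in the open set `Ω` times a locally integrable
function on `Ω` is integrable on `Ω`. -/
theorem integrableOn_test_smul {Ω : Set ℝ} (hΩ : IsOpen Ω) {u : ℝ → ℂ}
    (hu : LocallyIntegrableOn u Ω) {f : ℝ → ℝ} (hf : Continuous f)
    (hc : HasCompactSupport f) (hs : tsupport f ⊆ Ω) :
    IntegrableOn (fun x => f x • u x) Ω := by
  have h1 : IntegrableOn u (tsupport f) := hu.integrableOn_compact_subset hs hc
  have h2 : IntegrableOn (fun x => f x • u x) (tsupport f) :=
    h1.continuousOn_smul hf.continuousOn hc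
  refine (h2.of_forall_sdiff_eq_zero hΩ.measurableSet ?_)
  intro x hx
  simp [image_eq_zero_of_notMem_tsupport hx.2]

theorem HasWeakDeriv.add {Ω : Set ℝ} (hΩ : IsOpen Ω) {k : ℕ} {u₁ w₁ u₂ w₂ : ℝ → ℂ}
    (h₁ : HasWeakDeriv Ω k u₁ w₁) (h₂ : HasWeakDeriv Ω k u₂ w₂) :
    HasWeakDeriv Ω k (fun x => u₁ x + u₂ x) (fun x => w₁ x + w₂ x) where
  locInt := h₁.locInt.add h₂.locInt
  locInt' := h₁.locInt'.add h₂.locInt'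
  integral_eq := by
    intro φ h1 h2 h3
    have hc : Continuous (iteratedDeriv k φ) :=
      h1.continuous_iteratedDeriv k (by exact_mod_cast le_top)
    have hts : tsupport (iteratedDeriv k φ) ⊆ tsupport φ := by
      refine closure_minimal ?_ (isClosed_tsupport φ)
      intro x hx
      have : x ∈ Function.support (iteratedFDeriv ℝ k φ) := by
        intro h0
        apply hx
        rw [iteratedDeriv_eq_iteratedFDeriv, h0]
        simp
      exact support_iteratedFDeriv_subset k this
    have hcs : HasCompactSupport (iteratedDeriv k φ) :=
      h2.of_isClosed_subset (isClosed_tsupport _) hts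
    simp only [smul_add]
    rw [integral_add (integrableOn_test_smul hΩ h₁.locInt hc hcs (hts.trans h3))
        (integrableOn_test_smul hΩ h₂.locInt hc hcs (hts.trans h3)),
      integral_add (integrableOn_test_smul hΩ h₁.locInt' h1.continuous h2 h3)
        (integrableOn_test_smul hΩ h₂.locInt' h1.continuous h2 h3),
      h₁.integral_eq φ h1 h2 h3, h₂.integral_eq φ h1 h2 h3]
    ring

theorem locallyIntegrableOn_congr_ae {Ω : Set ℝ} {u u' : ℝ → ℂ}
    (h : LocallyIntegrableOn u Ω) (hu : u =ᵐ[volume.restrict Ω] u') :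
    LocallyIntegrableOn u' Ω := by
  intro x hx
  obtain ⟨t, ht, hi⟩ := h x hx
  refine ⟨t ∩ Ω, Filter.inter_mem ht self_mem_nhdsWithin, ?_⟩
  exact (hi.mono_set inter_subset_left).congr_fun_ae
    (ae_restrict_of_ae_restrict_of_subset inter_subset_right hu)

theorem HasWeakDeriv.congr {Ω : Set ℝ} {k : ℕ} {u w u' w' : ℝ → ℂ}
    (h : HasWeakDeriv Ω k u w) (hu : u =ᵐ[volume.restrict Ω] u')
    (hw : w =ᵐ[volume.restrict Ω] w') : HasWeakDeriv Ω k u' w' where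
  locInt := locallyIntegrableOn_congr_ae h.locInt hu
  locInt' := locallyIntegrableOn_congr_ae h.locInt' hw
  integral_eq := by
    intro φ h1 h2 h3
    have e1 : ∫ x in Ω, iteratedDeriv k φ x • u' x = ∫ x in Ω, iteratedDeriv k φ x • u x :=
      integral_congr_ae (hu.mono fun x hx => by simp only [hx])
    have e2 : ∫ x in Ω, φ x • w' x = ∫ x in Ω, φ x • w x :=
      integral_congr_ae (hw.mono fun x hx => by simp only [hx])
    rw [e1, e2]
    exact h.integral_eq φ h1 h2 h3

theorem HasWeakDeriv.ae_unique {Ω : Set ℝ} (hΩ : IsOpen Ω) {k : ℕ} {u w w' : ℝ → ℂ}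
    (h : HasWeakDeriv Ω k u w) (h' : HasWeakDeriv Ω k u w') :
    ∀ᵐ x, x ∈ Ω → w x = w' x := by
  have key := hΩ.ae_eq_zero_of_integral_contDiff_smul_eq_zero (h.locInt'.sub h'.locInt') (by
    intro φ h1 h2 h3
    have i1 := integrableOn_test_smul hΩ h.locInt' h1.continuous h2 h3
    have i2 := integrableOn_test_smul hΩ h'.locInt' h1.continuous h2 h3
    have e := (h.integral_eq φ h1 h2 h3).symm.trans (h'.integral_eq φ h1 h2 h3)
    have e' : ∫ x in Ω, φ x • w x = ∫ x in Ω, φ x • w' x :=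
      mul_left_cancel₀ (pow_ne_zero k (by norm_num)) e
    rw [← setIntegral_eq_integral_of_forall_compl_eq_zero (s := Ω)]
    · simp only [Pi.sub_apply, smul_sub]
      rw [integral_sub i1 i2, e', sub_self]
    · intro x hx
      rw [image_eq_zero_of_notMem_tsupport (fun hx' => hx (h3 hx')), zero_smul])
  filter_upwards [key] with x hx hxΩ
  exact sub_eq_zero.mp (hx hxΩ)

theorem MemHk.congr {Ω : Set ℝ} {k : ℕ} {u u' : ℝ → ℂ} (h : MemHk Ω k u)
    (hu : u =ᵐ[volume.restrict Ω] u') : MemHk Ω k u' := by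
  intro j hj
  obtain ⟨w, hw, hd⟩ := h j hj
  exact ⟨w, hw, hd.congr hu (Filter.EventuallyEq.refl _ _)⟩

theorem MemHk.add {Ω : Set ℝ} (hΩ : IsOpen Ω) {k : ℕ} {u₁ u₂ : ℝ → ℂ} (h₁ : MemHk Ω k u₁)
    (h₂ : MemHk Ω k u₂) : MemHk Ω k (fun x => u₁ x + u₂ x) := by
  intro j hj
  obtain ⟨w₁, hw₁, hd₁⟩ := h₁ j hj
  obtain ⟨w₂, hw₂, hd₂⟩ := h₂ j hj
  exact ⟨_, hw₁.add hw₂, hd₁.add hΩ hd₂⟩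

theorem MemHk.smul {Ω : Set ℝ} {k : ℕ} {u : ℝ → ℂ} (c : ℂ) (h : MemHk Ω k u) :
    MemHk Ω k (fun x => c * u x) := by
  intro j hj
  obtain ⟨w, hw, hd⟩ := h j hj
  exact ⟨_, hw.const_mul c, hd.smul c⟩

theorem memHk_zero (Ω : Set ℝ) (k : ℕ) : MemHk Ω k (fun _ => (0 : ℂ)) :=
  fun j _ => ⟨_, MemLp.zero, hasWeakDeriv_zero Ω j⟩

theorem HasTrace.congr {c d : ℝ} {j : ℕ} {u u' : ℝ → ℂ} {x : ℝ} {y : ℂ}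
    (h : HasTrace c d j u x y) (hu : u =ᵐ[volume.restrict (Ioo c d)] u') :
    HasTrace c d j u' x y := by
  obtain ⟨g, hg, hd, he⟩ := h
  exact ⟨g, hg, hd.congr hu (Filter.EventuallyEq.refl _ _), he⟩

theorem HasTrace.add {c d : ℝ} {j : ℕ} {u₁ u₂ : ℝ → ℂ} {x : ℝ} {y₁ y₂ : ℂ}
    (h₁ : HasTrace c d j u₁ x y₁) (h₂ : HasTrace c d j u₂ x y₂) :
    HasTrace c d j (fun x => u₁ x + u₂ x) x (y₁ + y₂) := by
  obtain ⟨g₁, hg₁, hd₁, he₁⟩ := h₁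
  obtain ⟨g₂, hg₂, hd₂, he₂⟩ := h₂
  exact ⟨_, hg₁.add hg₂, hd₁.add isOpen_Ioo hd₂, by simp [he₁, he₂]⟩

theorem HasTrace.smul {c d : ℝ} {j : ℕ} {u : ℝ → ℂ} {x : ℝ} {y : ℂ} (r : ℂ)
    (h : HasTrace c d j u x y) : HasTrace c d j (fun x => r * u x) x (r * y) := by
  obtain ⟨g, hg, hd, he⟩ := h
  exact ⟨_, hg.const_smul r, hd.smul r, by simp [he]⟩

theorem hasTrace_zero (c d : ℝ) (j : ℕ) (x : ℝ) : HasTrace c d j (fun _ => (0 : ℂ)) x 0 :=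
  ⟨_, continuousOn_const, hasWeakDeriv_zero _ j, rfl⟩

/-- The complex Hilbert space `L²(0, 1)`. -/
abbrev L2I : Type := Lp ℂ 2 (volume.restrict (Ioo (0 : ℝ) 1))

theorem L2I.ae_of_subset {Ω : Set ℝ} (hΩ : Ω ⊆ Ioo 0 1) {p : ℝ → Prop}
    (h : ∀ᵐ x ∂(volume.restrict (Ioo (0 : ℝ) 1)), p x) : ∀ᵐ x ∂(volume.restrict Ω), p x :=
  ae_restrict_of_ae_restrict_of_subset hΩ h

theorem L2I.coe_add {Ω : Set ℝ} (hΩ : Ω ⊆ Ioo 0 1) (u v : L2I) :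
    (fun x => u x + v x) =ᵐ[volume.restrict Ω] ((u + v : L2I) : ℝ → ℂ) :=
  L2I.ae_of_subset hΩ (Lp.coeFn_add u v).symm

theorem L2I.coe_smul {Ω : Set ℝ} (hΩ : Ω ⊆ Ioo 0 1) (c : ℂ) (u : L2I) :
    (fun x => c * u x) =ᵐ[volume.restrict Ω] ((c • u : L2I) : ℝ → ℂ) :=
  L2I.ae_of_subset hΩ (Lp.coeFn_smul c u).symm

theorem L2I.coe_zero {Ω : Set ℝ} (hΩ : Ω ⊆ Ioo 0 1) :
    (fun _ => (0 : ℂ)) =ᵐ[volume.restrict Ω] ((0 : L2I) : ℝ → ℂ) :=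
  L2I.ae_of_subset hΩ (Lp.coeFn_zero ℂ 2 _).symm

/-- The energy space `[H²(0, 1) ∩ H¹₀(0, 1)] × L²(0, 1)`; in one dimension membership of an
`H²` function in `H¹₀` means that its continuous representative vanishes at `0` and `1`. -/
def energySpace : Submodule ℂ (L2I × L2I) where
  carrier := {U | MemHk (Ioo 0 1) 2 U.1 ∧ HasTrace 0 1 0 U.1 0 0 ∧ HasTrace 0 1 0 U.1 1 0}
  zero_mem' :=
    have e := L2I.coe_zero (le_refl (Ioo (0 : ℝ) 1))
    ⟨(memHk_zero _ _).congr e, (hasTrace_zero _ _ _ _).congr e, (hasTrace_zero _ _ _ _).congr e⟩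
  add_mem' := by
    rintro U V ⟨h1, h2, h3⟩ ⟨k1, k2, k3⟩
    have e := L2I.coe_add (le_refl (Ioo (0 : ℝ) 1)) U.1 V.1
    exact ⟨(h1.add isOpen_Ioo k1).congr e, by simpa using (h2.add k2).congr e,
      by simpa using (h3.add k3).congr e⟩
  smul_mem' := by
    rintro c U ⟨h1, h2, h3⟩
    have e := L2I.coe_smul (le_refl (Ioo (0 : ℝ) 1)) c U.1
    exact ⟨(h1.smul c).congr e, by simpa using (h2.smul c).congr e,
      by simpa using (h3.smul c).congr e⟩

open Classical in
/-- The second weak derivative `u_xx ∈ L²(0, 1)` of `u ∈ H²(0, 1)` (it is unique in `L²`). -/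
noncomputable def secondDeriv (u : L2I) : L2I :=
  if h : ∃ w : L2I, HasWeakDeriv (Ioo 0 1) 2 u w then h.choose else 0

/-- The inner product `∫₀¹ (a u₁_xx conj(u₂_xx) + v₁ conj(v₂)) dx` of the energy space. -/
noncomputable def energyInner (a : ℝ) (U₁ U₂ : energySpace) : ℂ :=
  a * inner ℂ (secondDeriv U₂.1.1) (secondDeriv U₁.1.1) + inner ℂ U₂.1.2 U₁.1.2

/-- The norm of the energy space. -/
noncomputable def energyNorm (a : ℝ) (U : energySpace) : ℝ :=
  Real.sqrt (energyInner a U U).re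

/-- `w` is the fourth weak derivative of `u` on each of the intervals `(0, ξ)` and `(ξ, 1)`. -/
def IsFourthDeriv (ξ : ℝ) (u w : L2I) : Prop :=
  HasWeakDeriv (Ioo 0 ξ) 4 u w ∧ HasWeakDeriv (Ioo ξ 1) 4 u w

theorem IsFourthDeriv.unique {ξ : ℝ} {u w w' : L2I} (h : IsFourthDeriv ξ u w)
    (h' : IsFourthDeriv ξ u w') : w = w' := by
  apply Lp.ext
  rw [Filter.EventuallyEq, ae_restrict_iff' measurableSet_Ioo]
  have hne : ∀ᵐ x : ℝ, x ≠ ξ := by simp [ae_iff]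
  filter_upwards [h.1.ae_unique isOpen_Ioo h'.1, h.2.ae_unique isOpen_Ioo h'.2, hne]
    with x h1 h2 h3 hx
  rcases lt_or_gt_of_ne h3 with hlt | hlt
  · exact h1 ⟨hx.1, hlt⟩
  · exact h2 ⟨hlt, hx.2⟩

theorem left_subset {ξ : ℝ} (hξ : ξ ∈ Ioo (0 : ℝ) 1) : Ioo 0 ξ ⊆ Ioo (0 : ℝ) 1 :=
  Ioo_subset_Ioo_right hξ.2.le

theorem right_subset {ξ : ℝ} (hξ : ξ ∈ Ioo (0 : ℝ) 1) : Ioo ξ 1 ⊆ Ioo (0 : ℝ) 1 :=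
  Ioo_subset_Ioo_left hξ.1.le

theorem IsFourthDeriv.add {ξ : ℝ} (hξ : ξ ∈ Ioo (0 : ℝ) 1) {u₁ u₂ w₁ w₂ : L2I}
    (h₁ : IsFourthDeriv ξ u₁ w₁) (h₂ : IsFourthDeriv ξ u₂ w₂) :
    IsFourthDeriv ξ (u₁ + u₂) (w₁ + w₂) :=
  ⟨(h₁.1.add isOpen_Ioo h₂.1).congr (L2I.coe_add (left_subset hξ) _ _)
      (L2I.coe_add (left_subset hξ) _ _),
    (h₁.2.add isOpen_Ioo h₂.2).congr (L2I.coe_add (right_subset hξ) _ _)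
      (L2I.coe_add (right_subset hξ) _ _)⟩

theorem IsFourthDeriv.smul {ξ : ℝ} (hξ : ξ ∈ Ioo (0 : ℝ) 1) {u w : L2I} (c : ℂ)
    (h : IsFourthDeriv ξ u w) : IsFourthDeriv ξ (c • u) (c • w) :=
  ⟨(h.1.smul c).congr (L2I.coe_smul (left_subset hξ) _ _) (L2I.coe_smul (left_subset hξ) _ _),
    (h.2.smul c).congr (L2I.coe_smul (right_subset hξ) _ _)
      (L2I.coe_smul (right_subset hξ) _ _)⟩

theorem exists_isFourthDeriv {ξ : ℝ} (hξ : ξ ∈ Ioo (0 : ℝ) 1) {u : L2I}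
    (h₁ : MemHk (Ioo 0 ξ) 4 u) (h₂ : MemHk (Ioo ξ 1) 4 u) : ∃ w : L2I, IsFourthDeriv ξ u w := by
  obtain ⟨w₁, hw₁, hd₁⟩ := h₁ 4 le_rfl
  obtain ⟨w₂, hw₂, hd₂⟩ := h₂ 4 le_rfl
  have m₁ : MemLp ((Ioo 0 ξ).indicator w₁) 2 (volume.restrict (Ioo (0 : ℝ) 1)) :=
    ((memLp_indicator_iff_restrict measurableSet_Ioo).2 hw₁).restrict _
  have m₂ : MemLp ((Ioo ξ 1).indicator w₂) 2 (volume.restrict (Ioo (0 : ℝ) 1)) :=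
    ((memLp_indicator_iff_restrict measurableSet_Ioo).2 hw₂).restrict _
  have hc := (m₁.add m₂).coeFn_toLp
  refine ⟨(m₁.add m₂).toLp _, hd₁.congr (Filter.EventuallyEq.refl _ _) ?_,
    hd₂.congr (Filter.EventuallyEq.refl _ _) ?_⟩
  · filter_upwards [L2I.ae_of_subset (left_subset hξ) hc, ae_restrict_mem measurableSet_Ioo]
      with x hx hxm
    rw [hx, Pi.add_apply, indicator_of_mem hxm,
      indicator_of_notMem (fun h => absurd h.1 (not_lt.2 hxm.2.le)), add_zero]
  · filter_upwards [L2I.ae_of_subset (right_subset hξ) hc, ae_restrict_mem measurableSet_Ioo]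
      with x hx hxm
    rw [hx, Pi.add_apply, indicator_of_mem hxm,
      indicator_of_notMem (fun h => absurd h.2 (not_lt.2 hxm.1.le)), zero_add]

/-- The conditions that define the domain of the beam operator, for `U = (u, v)`. -/
structure InBeamDomain (a α ξ : ℝ) (u v : L2I) : Prop where
  u_left : MemHk (Ioo 0 ξ) 4 u
  u_right : MemHk (Ioo ξ 1) 4 u
  u_H2 : MemHk (Ioo 0 1) 2 u
  v_H2 : MemHk (Ioo 0 1) 2 v
  u_zero : HasTrace 0 1 0 u 0 0
  u_one : HasTrace 0 1 0 u 1 0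
  v_zero : HasTrace 0 1 0 v 0 0
  v_one : HasTrace 0 1 0 v 1 0
  uxx_zero : HasTrace 0 ξ 2 u 0 0
  uxx_one : HasTrace ξ 1 2 u 1 0
  /-- `u_xx(ξ⁻) = u_xx(ξ⁺)` -/
  uxx_cont : ∃ m : ℂ, HasTrace 0 ξ 2 u ξ m ∧ HasTrace ξ 1 2 u ξ m
  /-- `u_xxx(ξ⁺) - u_xxx(ξ⁻) = -(α / a) v(ξ)` -/
  uxxx_jump : ∃ p m y : ℂ, HasTrace ξ 1 3 u ξ p ∧ HasTrace 0 ξ 3 u ξ m ∧ HasTrace 0 1 0 v ξ y ∧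
    p - m = -(α / a) * y

/-- The domain `D(𝒜)` of the beam operator. -/
def beamDomain (a α ξ : ℝ) (hξ : ξ ∈ Ioo (0 : ℝ) 1) : Submodule ℂ energySpace where
  carrier := {U | InBeamDomain a α ξ U.1.1 U.1.2}
  zero_mem' := by
    have e := L2I.coe_zero (le_refl (Ioo (0 : ℝ) 1))
    have e1 := L2I.coe_zero (left_subset hξ)
    have e2 := L2I.coe_zero (right_subset hξ)
    exact
    { u_left := (memHk_zero _ _).congr e1
      u_right := (memHk_zero _ _).congr e2
      u_H2 := (memHk_zero _ _).congr e
      v_H2 := (memHk_zero _ _).congr e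
      u_zero := (hasTrace_zero _ _ _ _).congr e
      u_one := (hasTrace_zero _ _ _ _).congr e
      v_zero := (hasTrace_zero _ _ _ _).congr e
      v_one := (hasTrace_zero _ _ _ _).congr e
      uxx_zero := (hasTrace_zero _ _ _ _).congr e1
      uxx_one := (hasTrace_zero _ _ _ _).congr e2
      uxx_cont := ⟨0, (hasTrace_zero _ _ _ _).congr e1, (hasTrace_zero _ _ _ _).congr e2⟩
      uxxx_jump := ⟨0, 0, 0, (hasTrace_zero _ _ _ _).congr e2, (hasTrace_zero _ _ _ _).congr e1,
        (hasTrace_zero _ _ _ _).congr e, by simp⟩ }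
  add_mem' := by
    intro U V h k
    have eu := L2I.coe_add (le_refl (Ioo (0 : ℝ) 1)) U.1.1 V.1.1
    have ev := L2I.coe_add (le_refl (Ioo (0 : ℝ) 1)) U.1.2 V.1.2
    have e1 := L2I.coe_add (left_subset hξ) U.1.1 V.1.1
    have e2 := L2I.coe_add (right_subset hξ) U.1.1 V.1.1
    obtain ⟨m, hm1, hm2⟩ := h.uxx_cont
    obtain ⟨m', km1, km2⟩ := k.uxx_cont
    obtain ⟨p, q, y, hp, hq, hy, hj⟩ := h.uxxx_jump
    obtain ⟨p', q', y', kp, kq, ky, kj⟩ := k.uxxx_jump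
    exact
    { u_left := (h.u_left.add isOpen_Ioo k.u_left).congr e1
      u_right := (h.u_right.add isOpen_Ioo k.u_right).congr e2
      u_H2 := (h.u_H2.add isOpen_Ioo k.u_H2).congr eu
      v_H2 := (h.v_H2.add isOpen_Ioo k.v_H2).congr ev
      u_zero := by simpa using (h.u_zero.add k.u_zero).congr eu
      u_one := by simpa using (h.u_one.add k.u_one).congr eu
      v_zero := by simpa using (h.v_zero.add k.v_zero).congr ev
      v_one := by simpa using (h.v_one.add k.v_one).congr ev
      uxx_zero := by simpa using (h.uxx_zero.add k.uxx_zero).congr e1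
      uxx_one := by simpa using (h.uxx_one.add k.uxx_one).congr e2
      uxx_cont := ⟨_, (hm1.add km1).congr e1, (hm2.add km2).congr e2⟩
      uxxx_jump := ⟨_, _, _, (hp.add kp).congr e2, (hq.add kq).congr e1, (hy.add ky).congr ev,
        by linear_combination hj + kj⟩ }
  smul_mem' := by
    intro c U h
    have eu := L2I.coe_smul (le_refl (Ioo (0 : ℝ) 1)) c U.1.1
    have ev := L2I.coe_smul (le_refl (Ioo (0 : ℝ) 1)) c U.1.2
    have e1 := L2I.coe_smul (left_subset hξ) c U.1.1
    have e2 := L2I.coe_smul (right_subset hξ) c U.1.1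
    obtain ⟨m, hm1, hm2⟩ := h.uxx_cont
    obtain ⟨p, q, y, hp, hq, hy, hj⟩ := h.uxxx_jump
    exact
    { u_left := (h.u_left.smul c).congr e1
      u_right := (h.u_right.smul c).congr e2
      u_H2 := (h.u_H2.smul c).congr eu
      v_H2 := (h.v_H2.smul c).congr ev
      u_zero := by simpa using (h.u_zero.smul c).congr eu
      u_one := by simpa using (h.u_one.smul c).congr eu
      v_zero := by simpa using (h.v_zero.smul c).congr ev
      v_one := by simpa using (h.v_one.smul c).congr ev
      uxx_zero := by simpa using (h.uxx_zero.smul c).congr e1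
      uxx_one := by simpa using (h.uxx_one.smul c).congr e2
      uxx_cont := ⟨_, (hm1.smul c).congr e1, (hm2.smul c).congr e2⟩
      uxxx_jump := ⟨_, _, _, (hp.smul c).congr e2, (hq.smul c).congr e1, (hy.smul c).congr ev,
        by linear_combination c * hj⟩ }

theorem beamDomain_exists {a α ξ : ℝ} (hξ : ξ ∈ Ioo (0 : ℝ) 1) (U : beamDomain a α ξ hξ) :
    ∃ w : L2I, IsFourthDeriv ξ U.1.1.1 w :=
  exists_isFourthDeriv hξ U.2.u_left U.2.u_right

/-- The fourth derivative of `u` off the point `ξ`, for `(u, v) ∈ D(𝒜)`. -/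
noncomputable def fourthDeriv {a α ξ : ℝ} (hξ : ξ ∈ Ioo (0 : ℝ) 1) (U : beamDomain a α ξ hξ) :
    L2I :=
  (beamDomain_exists hξ U).choose

theorem fourthDeriv_spec {a α ξ : ℝ} (hξ : ξ ∈ Ioo (0 : ℝ) 1) (U : beamDomain a α ξ hξ) :
    IsFourthDeriv ξ U.1.1.1 (fourthDeriv hξ U) :=
  (beamDomain_exists hξ U).choose_spec

theorem fourthDeriv_add {a α ξ : ℝ} (hξ : ξ ∈ Ioo (0 : ℝ) 1) (U V : beamDomain a α ξ hξ) :
    fourthDeriv hξ (U + V) = fourthDeriv hξ U + fourthDeriv hξ V :=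
  (fourthDeriv_spec hξ (U + V)).unique ((fourthDeriv_spec hξ U).add hξ (fourthDeriv_spec hξ V))

theorem fourthDeriv_smul {a α ξ : ℝ} (hξ : ξ ∈ Ioo (0 : ℝ) 1) (c : ℂ)
    (U : beamDomain a α ξ hξ) : fourthDeriv hξ (c • U) = c • fourthDeriv hξ U :=
  (fourthDeriv_spec hξ (c • U)).unique ((fourthDeriv_spec hξ U).smul hξ c)

/-- `fourthDeriv` as a linear map on `D(𝒜)`. -/
noncomputable def fourthDerivL {a α ξ : ℝ} (hξ : ξ ∈ Ioo (0 : ℝ) 1) :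
    beamDomain a α ξ hξ →ₗ[ℂ] L2I where
  toFun := fourthDeriv hξ
  map_add' := fourthDeriv_add hξ
  map_smul' := fourthDeriv_smul hξ

/-- The linear map `(u, v) ↦ v` on `D(𝒜)`. -/
noncomputable def velocityL {a α ξ : ℝ} (hξ : ξ ∈ Ioo (0 : ℝ) 1) : beamDomain a α ξ hξ →ₗ[ℂ] L2I :=
  (LinearMap.snd ℂ L2I L2I ∘ₗ energySpace.subtype) ∘ₗ (beamDomain a α ξ hξ).subtype

/-- The unbounded operator `𝒜(u, v) = (v, -a u_xxxx - b v - α v(ξ) δ_ξ)` in the energy space,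
with domain `D(𝒜)`.  As a distribution on `(0, 1)`, `u_xxxx` is the sum of the `L²` function
`fourthDeriv` (the fourth derivative on `(0, ξ)` and on `(ξ, 1)`) and of
`(u_xxx(ξ⁺) - u_xxx(ξ⁻)) δ_ξ`, and by the jump condition `-a` times the latter cancels
`-α v(ξ) δ_ξ`; what remains is the `L²` function in the second component. -/
noncomputable def beamOperator (a b α ξ : ℝ) (hξ : ξ ∈ Ioo (0 : ℝ) 1) :
    energySpace →ₗ.[ℂ] energySpace where
  domain := beamDomain a α ξ hξ
  toFun := LinearMap.codRestrict energySpace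
    ((velocityL hξ).prod (-((a : ℂ) • fourthDerivL hξ) - (b : ℂ) • velocityL hξ))
    (fun U => ⟨U.2.v_H2, U.2.v_zero, U.2.v_one⟩)

theorem beamOperator_fst (a b α ξ : ℝ) (hξ : ξ ∈ Ioo (0 : ℝ) 1) (U : beamDomain a α ξ hξ) :
    (beamOperator a b α ξ hξ U).1.1 = U.1.1.2 :=
  rfl

theorem beamOperator_snd (a b α ξ : ℝ) (hξ : ξ ∈ Ioo (0 : ℝ) 1) (U : beamDomain a α ξ hξ) :
    (beamOperator a b α ξ hξ U).1.2 = -((a : ℂ) • fourthDeriv hξ U) - (b : ℂ) • U.1.1.2 :=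
  rfl

/-- `μ` is an eigenvalue of the unbounded operator `T`. -/
def IsEigenvalue (T : energySpace →ₗ.[ℂ] energySpace) (μ : ℂ) : Prop :=
  ∃ U : T.domain, U ≠ 0 ∧ T U = μ • (U : energySpace)

/-- The resolvent set of `T` in the energy space with norm `energyNorm a`: the `μ` for which
`μ - T : D(T) → 𝓗` is bijective with bounded inverse. -/
def resolventSetOf (a : ℝ) (T : energySpace →ₗ.[ℂ] energySpace) : Set ℂ :=
  {μ | Function.Bijective (fun U : T.domain => μ • (U : energySpace) - T U) ∧
    ∃ C : ℝ, ∀ U : T.domain, energyNorm a U ≤ C * energyNorm a (μ • (U : energySpace) - T U)}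

/-- The spectrum of `T` in the energy space with norm `energyNorm a`. -/
def spectrumOf (a : ℝ) (T : energySpace →ₗ.[ℂ] energySpace) : Set ℂ :=
  (resolventSetOf a T)ᶜ

/-!
Pairing the eigenvalue equation with the displacement `u` in `L²(0, 1)` and integrating by parts
twice on each side of `ξ` turns the jump of `u'''` into the damping term: an eigenvalue `μ`
satisfies `a ‖u''‖² + α μ |u(ξ)|² + μ (μ + b) ‖u‖² = 0`, where `π⁴ ‖u‖² ≤ ‖u''‖²` by Wirtinger's
inequality. If `re μ > -b/2`, the imaginary part of this identity makes `μ` real, and then, as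
`|u(ξ)|² ≤ ‖u''‖²`, a small `α` moves the bound on `re μ` only slightly away from the largest real
part of a root of `x² + b x + a π⁴`. For `α = 0` that root is an eigenvalue, with eigenfunction
`sin (π x)`. To its right there is no spectrum at all: with `G` the solution operator of the
Dirichlet problem `u'' = f`, the resolvent equation for `p = u''''` reads
`a p + μ (μ + b) G² p = g`, and the symbol `a + μ (μ + b) θ` does not vanish for `θ ∈ [0, π⁻⁴]`,
which contains the numerical range of `G²`, so the Lax–Milgram theorem applies.
-/

/-! ### Primitives -/

section Primitive

variable {E : Type*} [NormedAddCommGroup E] [NormedSpace ℝ E]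
  {𝕜 : Type*} [RCLike 𝕜] {c d : ℝ}

theorem absolutelyContinuousOnInterval_integral {f : ℝ → E}
    (hf : IntervalIntegrable f volume c d) :
    AbsolutelyContinuousOnInterval (fun x => ∫ t in c..x, f t) c d := by
  have h_norm := hf.norm.absolutelyContinuousOnInterval_intervalIntegral (c := c) left_mem_uIcc
  unfold AbsolutelyContinuousOnInterval at h_norm ⊢
  refine squeeze_zero'
    (Filter.Eventually.of_forall fun _ => Finset.sum_nonneg fun _ _ => dist_nonneg) ?_ h_norm
  rw [Filter.eventually_inf_principal]
  filter_upwards with I hI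
  refine Finset.sum_le_sum fun i hi => ?_
  obtain ⟨hleft, hright⟩ := hI.1 i hi
  have int_left := hf.mono_set (uIcc_subset_uIcc_left hleft)
  have int_right := hf.mono_set (uIcc_subset_uIcc_left hright)
  rw [dist_eq_norm, dist_eq_norm, intervalIntegral.integral_interval_sub_left int_left int_right,
    intervalIntegral.integral_interval_sub_left int_left.norm int_right.norm, Real.norm_eq_abs]
  exact intervalIntegral.norm_integral_le_abs_integral_norm

/-- `F` is a primitive on `[c, d]` of the integrable function `f`: equivalently, `F` is absolutely
continuous with derivative `f` almost everywhere. It is the continuous representative through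
which weak derivatives on `(c, d)` are handled. -/
structure IsPrimitive (c d : ℝ) (F f : ℝ → E) : Prop where
  le : c ≤ d
  intervalIntegrable : IntervalIntegrable f volume c d
  eq_add_integral : ∀ x ∈ Icc c d, F x = F c + ∫ t in c..x, f t

namespace IsPrimitive

variable {F f : ℝ → E}

theorem of_intervalIntegrable (hcd : c ≤ d) (hf : IntervalIntegrable f volume c d) (C : E) :
    IsPrimitive c d (fun x => C + ∫ t in c..x, f t) f :=
  ⟨hcd, hf, fun x _ => by rw [intervalIntegral.integral_same, add_zero]⟩

theorem absolutelyContinuousOnInterval (h : IsPrimitive c d F f) :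
    AbsolutelyContinuousOnInterval F c d := by
  have h_int := absolutelyContinuousOnInterval_integral h.intervalIntegrable
  unfold AbsolutelyContinuousOnInterval at h_int ⊢
  refine h_int.congr' ?_
  rw [Filter.EventuallyEq, Filter.eventually_inf_principal]
  filter_upwards with I hI
  refine Finset.sum_congr rfl fun i hi => ?_
  obtain ⟨hleft, hright⟩ := hI.1 i hi
  rw [uIcc_of_le h.le] at hleft hright
  rw [h.eq_add_integral _ hleft, h.eq_add_integral _ hright, dist_add_left]

theorem continuousOn (h : IsPrimitive c d F f) : ContinuousOn F (Icc c d) := by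
  simpa only [uIcc_of_le h.le] using h.absolutelyContinuousOnInterval.continuousOn

theorem intervalIntegrable_of_mem (h : IsPrimitive c d F f) {x y : ℝ} (hx : x ∈ Icc c d)
    (hy : y ∈ Icc c d) : IntervalIntegrable f volume x y :=
  h.intervalIntegrable.mono_set <| by
    rw [uIcc_of_le h.le]
    exact ordConnected_Icc.uIcc_subset hx hy

theorem sub_eq_integral (h : IsPrimitive c d F f) {x y : ℝ} (hx : x ∈ Icc c d)
    (hy : y ∈ Icc c d) : F y - F x = ∫ t in x..y, f t := by
  have hc := left_mem_Icc.2 h.le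
  rw [h.eq_add_integral x hx, h.eq_add_integral y hy, add_sub_add_left_eq_sub,
    intervalIntegral.integral_interval_sub_left (h.intervalIntegrable_of_mem hc hy)
      (h.intervalIntegrable_of_mem hc hx)]

theorem mono (h : IsPrimitive c d F f) {c' d' : ℝ} (hc : c ≤ c') (hcd' : c' ≤ d')
    (hd : d' ≤ d) : IsPrimitive c' d' F f where
  le := hcd'
  intervalIntegrable := h.intervalIntegrable_of_mem ⟨hc, hcd'.trans hd⟩ ⟨hc.trans hcd', hd⟩
  eq_add_integral x hx := by
    rw [← h.sub_eq_integral ⟨hc, hcd'.trans hd⟩ ⟨hc.trans hx.1, hx.2.trans hd⟩, add_sub_cancel]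

theorem congr_ae (h : IsPrimitive c d F f) {g : ℝ → E}
    (hfg : f =ᵐ[volume.restrict (Ioo c d)] g) : IsPrimitive c d F g where
  le := h.le
  intervalIntegrable := by
    have hf := h.intervalIntegrable
    rw [intervalIntegrable_iff_integrableOn_Ioo_of_le h.le] at hf ⊢
    exact hf.congr_fun_ae hfg
  eq_add_integral x hx := by
    rw [h.eq_add_integral x hx, intervalIntegral.integral_of_le hx.1,
      intervalIntegral.integral_of_le hx.1, integral_Ioc_eq_integral_Ioo,
      integral_Ioc_eq_integral_Ioo, integral_congr_ae
        (ae_restrict_of_ae_restrict_of_subset (Ioo_subset_Ioo_right hx.2) hfg)]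

section CompleteSpace

variable [CompleteSpace E]

theorem ae_hasDerivAt (h : IsPrimitive c d F f) :
    ∀ᵐ x, x ∈ uIcc c d → HasDerivAt F (f x) x := by
  filter_upwards [h.intervalIntegrable.ae_hasDerivAt_integral, volume.ae_ne c, volume.ae_ne d]
    with x hderiv hxc hxd hx
  have hx' : x ∈ Icc c d := uIcc_of_le h.le ▸ hx
  refine ((hderiv hx c left_mem_uIcc).const_add (F c)).congr_of_eventuallyEq ?_
  filter_upwards [Icc_mem_nhds (hx'.1.lt_of_ne' hxc) (hx'.2.lt_of_ne hxd)] with y hy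
    using h.eq_add_integral y hy

theorem of_absolutelyContinuousOnInterval (hcd : c ≤ d)
    (hF : AbsolutelyContinuousOnInterval F c d) (hf : IntervalIntegrable f volume c d)
    (hderiv : ∀ᵐ x, x ∈ uIcc c d → HasDerivAt F (f x) x) : IsPrimitive c d F f where
  le := hcd
  intervalIntegrable := hf
  eq_add_integral x hx := by
    obtain ⟨C, hC⟩ := (hF.fun_sub
      (absolutelyContinuousOnInterval_integral hf)).const_of_ae_hasDerivAt_zero (by
        filter_upwards [hderiv, hf.ae_hasDerivAt_integral] with y hFy hfy hy
        simpa only [sub_self] using (hFy hy).fun_sub (hfy hy c left_mem_uIcc))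
    have hCc := hC c left_mem_uIcc
    rw [intervalIntegral.integral_same, sub_zero] at hCc
    rw [hCc, ← hC x (by rwa [uIcc_of_le hcd]), sub_add_cancel]

theorem of_hasDerivAt (hcd : c ≤ d) (hderiv : ∀ x, HasDerivAt F (f x) x) (hf : Continuous f) :
    IsPrimitive c d F f where
  le := hcd
  intervalIntegrable := hf.intervalIntegrable _ _
  eq_add_integral x _ := by
    rw [intervalIntegral.integral_eq_sub_of_hasDerivAt (fun y _ => hderiv y)
      (hf.intervalIntegrable _ _), add_sub_cancel]

theorem hasDerivAt (h : IsPrimitive c d F f) (hf : ContinuousOn f (Icc c d)) {x : ℝ}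
    (hx : x ∈ Ioo c d) : HasDerivAt F (f x) x := by
  have hIcc : Icc c d ∈ nhds x := Icc_mem_nhds hx.1 hx.2
  have h_int : HasDerivAt (fun y => ∫ t in c..y, f t) (f x) x :=
    intervalIntegral.integral_hasDerivAt_right
      (h.intervalIntegrable_of_mem (left_mem_Icc.2 h.le) (Ioo_subset_Icc_self hx))
      ((hf.mono Ioo_subset_Icc_self).stronglyMeasurableAtFilter isOpen_Ioo x hx)
      (hf.continuousAt hIcc)
  refine (h_int.const_add (F c)).congr_of_eventuallyEq ?_
  filter_upwards [hIcc] with y hy using h.eq_add_integral y hy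

end CompleteSpace

section RCLike

variable {F f G g : ℝ → 𝕜}

theorem intervalIntegrable_mul (hF : IsPrimitive c d F f) (hG : IsPrimitive c d G g) :
    IntervalIntegrable (fun x => f x * G x) volume c d :=
  hF.intervalIntegrable.mul_continuousOn (by rw [uIcc_of_le hF.le]; exact hG.continuousOn)

theorem intervalIntegrable_mul' (hF : IsPrimitive c d F f) (hG : IsPrimitive c d G g) :
    IntervalIntegrable (fun x => F x * g x) volume c d :=
  hG.intervalIntegrable.continuousOn_mul (by rw [uIcc_of_le hF.le]; exact hF.continuousOn)

theorem mul (hF : IsPrimitive c d F f) (hG : IsPrimitive c d G g) :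
    IsPrimitive c d (fun x => F x * G x) (fun x => f x * G x + F x * g x) := by
  refine of_absolutelyContinuousOnInterval hF.le
    (hF.absolutelyContinuousOnInterval.fun_smul hG.absolutelyContinuousOnInterval)
    ((hF.intervalIntegrable_mul hG).add (hF.intervalIntegrable_mul' hG)) ?_
  filter_upwards [hF.ae_hasDerivAt, hG.ae_hasDerivAt] with x hFx hGx hx
    using (hFx hx).mul (hGx hx)

theorem integral_mul_eq_sub (hF : IsPrimitive c d F f) (hG : IsPrimitive c d G g) :
    ∫ x in c..d, F x * g x = F d * G d - F c * G c - ∫ x in c..d, f x * G x := by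
  rw [(hF.mul hG).sub_eq_integral (left_mem_Icc.2 hF.le) (right_mem_Icc.2 hF.le),
    intervalIntegral.integral_add (hF.intervalIntegrable_mul hG) (hF.intervalIntegrable_mul' hG),
    add_sub_cancel_left]

theorem conj (hF : IsPrimitive c d F f) :
    IsPrimitive c d (fun x => starRingEnd 𝕜 (F x)) (fun x => starRingEnd 𝕜 (f x)) where
  le := hF.le
  intervalIntegrable :=
    ⟨(RCLike.conjCLE (K := 𝕜)).toContinuousLinearMap.integrable_comp hF.intervalIntegrable.1,
      (RCLike.conjCLE (K := 𝕜)).toContinuousLinearMap.integrable_comp hF.intervalIntegrable.2⟩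
  eq_add_integral x hx := by
    rw [hF.eq_add_integral x hx, map_add, intervalIntegral.intervalIntegral_conj]

end RCLike

end IsPrimitive

end Primitive

/-! ### Weak derivatives -/

theorem exists_subset_Icc_of_isCompact {K : Set ℝ} {c d : ℝ} (hK : IsCompact K)
    (hsub : K ⊆ Ioo c d) : ∃ p q, c < p ∧ q < d ∧ K ⊆ Icc p q := by
  rcases K.eq_empty_or_nonempty with rfl | hne
  · exact ⟨c + 1, d - 1, by linarith, by linarith, empty_subset _⟩
  · obtain ⟨p, hp, hp_le⟩ := hK.exists_isLeast hne
    obtain ⟨q, hq, hle_q⟩ := hK.exists_isGreatest hne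
    exact ⟨p, q, (hsub hp).1, (hsub hq).2, fun x hx => ⟨hp_le hx, hle_q hx⟩⟩

/-- `φ` is a real test function on `Ω`: smooth, with compact support contained in `Ω`. -/
structure IsTestFunction (Ω : Set ℝ) (φ : ℝ → ℝ) : Prop where
  contDiff : ContDiff ℝ ∞ φ
  hasCompactSupport : HasCompactSupport φ
  tsupport_subset : tsupport φ ⊆ Ω

namespace IsTestFunction

variable {Ω Ω' : Set ℝ} {φ ψ : ℝ → ℝ} {c d : ℝ}

theorem mono (hφ : IsTestFunction Ω' φ) (hΩ : Ω' ⊆ Ω) : IsTestFunction Ω φ :=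
  ⟨hφ.contDiff, hφ.hasCompactSupport, hφ.tsupport_subset.trans hΩ⟩

theorem eq_zero_of_notMem (hφ : IsTestFunction Ω φ) {x : ℝ} (hx : x ∉ Ω) : φ x = 0 :=
  image_eq_zero_of_notMem_tsupport fun h => hx (hφ.tsupport_subset h)

theorem support_subset (hφ : IsTestFunction Ω φ) : Function.support φ ⊆ Ω :=
  (subset_tsupport φ).trans hφ.tsupport_subset

theorem integrable (hφ : IsTestFunction Ω φ) : Integrable φ :=
  hφ.contDiff.continuous.integrable_of_hasCompactSupport hφ.hasCompactSupport

theorem iteratedDeriv (hφ : IsTestFunction Ω φ) (k : ℕ) :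
    IsTestFunction Ω (iteratedDeriv k φ) := by
  induction k with
  | zero => rwa [iteratedDeriv_zero]
  | succ k ih =>
    rw [iteratedDeriv_succ]
    exact ⟨(contDiff_infty_iff_deriv.1 ih.contDiff).2, ih.hasCompactSupport.deriv,
      tsupport_deriv_subset.trans ih.tsupport_subset⟩

theorem sub_const_mul (hφ : IsTestFunction Ω φ) (hψ : IsTestFunction Ω ψ) (r : ℝ) :
    IsTestFunction Ω (fun x => φ x - r * ψ x) where
  contDiff := hφ.contDiff.sub (contDiff_const.mul hψ.contDiff)
  hasCompactSupport := hφ.hasCompactSupport.sub hψ.hasCompactSupport.mul_left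
  tsupport_subset := (tsupport_sub φ fun x => r * ψ x).trans <|
    union_subset hφ.tsupport_subset <|
      (tsupport_mul_subset_right (f := fun _ => r)).trans hψ.tsupport_subset

theorem integrableOn_smul (hΩ : IsOpen Ω) (hφ : IsTestFunction Ω φ) {u : ℝ → ℂ}
    (hu : LocallyIntegrableOn u Ω) : IntegrableOn (fun x => φ x • u x) Ω :=
  integrableOn_test_smul hΩ hu hφ.contDiff.continuous hφ.hasCompactSupport hφ.tsupport_subset

theorem setIntegral_smul_of_subset (hφ : IsTestFunction Ω' φ) (hΩ : MeasurableSet Ω)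
    (hsub : Ω' ⊆ Ω) (u : ℝ → ℂ) : ∫ x in Ω, φ x • u x = ∫ x in Ω', φ x • u x :=
  setIntegral_eq_of_subset_of_forall_sdiff_eq_zero hΩ hsub fun x hx => by
    rw [hφ.eq_zero_of_notMem hx.2, zero_smul]

theorem setIntegral_smul_const (hφ : IsTestFunction Ω φ) (C : ℂ) :
    ∫ x in Ω, φ x • C = (∫ x, φ x) • C := by
  rw [integral_smul_const, setIntegral_eq_integral_of_forall_compl_eq_zero fun x hx =>
    hφ.eq_zero_of_notMem hx]

theorem tsupport_primitive_subset (hψ : IsTestFunction (Ioo c d) ψ) (hint : ∫ x, ψ x = 0)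
    {p q : ℝ} (hp : c < p) (hsub : tsupport ψ ⊆ Icc p q) :
    tsupport (fun x => ∫ t in c..x, ψ t) ⊆ Icc p q := by
  refine closure_minimal (fun x hx => by_contra fun hpq => hx ?_) isClosed_Icc
  change ∫ t in c..x, ψ t = 0
  rcases lt_or_ge x p with hxp | hpx
  · refine (intervalIntegral.integral_congr fun t ht => ?_).trans intervalIntegral.integral_zero
    exact image_eq_zero_of_notMem_tsupport fun hmem =>
      (hsub hmem).1.not_gt (ht.2.trans_lt (max_lt hp hxp))
  · rw [intervalIntegral.integral_eq_integral_of_support_subset, hint]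
    exact fun t ht => ⟨(hψ.support_subset ht).1,
      (hsub (subset_tsupport ψ ht)).2.trans (not_le.1 fun hxq => hpq ⟨hpx, hxq⟩).le⟩

theorem exists_deriv_eq (hψ : IsTestFunction (Ioo c d) ψ) (hint : ∫ x, ψ x = 0) :
    ∃ Ψ : ℝ → ℝ, IsTestFunction (Ioo c d) Ψ ∧ deriv Ψ = ψ := by
  obtain ⟨p, q, hp, hq, hsub⟩ :=
    exists_subset_Icc_of_isCompact hψ.hasCompactSupport.isCompact hψ.tsupport_subset
  have hsupp := hψ.tsupport_primitive_subset hint hp hsub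
  have hderiv : ∀ x, HasDerivAt (fun y => ∫ t in c..y, ψ t) (ψ x) x := fun x =>
    (hψ.contDiff.continuous.integral_hasStrictDerivAt c x).hasDerivAt
  have hderiv_eq : deriv (fun y => ∫ t in c..y, ψ t) = ψ := funext fun x => (hderiv x).deriv
  refine ⟨_, ⟨?_, isCompact_Icc.of_isClosed_subset (isClosed_tsupport _) hsupp,
    hsupp.trans (Icc_subset_Ioo hp hq)⟩, hderiv_eq⟩
  rw [contDiff_infty_iff_deriv, hderiv_eq]
  exact ⟨fun x => (hderiv x).differentiableAt, hψ.contDiff⟩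

end IsTestFunction

theorem exists_isTestFunction_integral_eq_one {Ω : Set ℝ} (hΩ : IsOpen Ω) (hne : Ω.Nonempty) :
    ∃ η : ℝ → ℝ, IsTestFunction Ω η ∧ ∫ x, η x = 1 := by
  obtain ⟨x, hx⟩ := hne
  obtain ⟨r, hr, hball⟩ := Metric.nhds_basis_closedBall.mem_iff.1 (hΩ.mem_nhds hx)
  let φ : ContDiffBump x := ⟨r / 2, r, half_pos hr, half_lt_self hr⟩
  exact ⟨φ.normed volume, ⟨φ.contDiff_normed, φ.hasCompactSupport_normed,
    φ.tsupport_normed_eq.trans_subset hball⟩, φ.integral_normed⟩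

theorem iteratedDeriv_iteratedDeriv {𝕜 F : Type*} [NontriviallyNormedField 𝕜]
    [NormedAddCommGroup F] [NormedSpace 𝕜 F] (j k : ℕ) (f : 𝕜 → F) :
    iteratedDeriv j (iteratedDeriv k f) = iteratedDeriv (j + k) f := by
  simp only [iteratedDeriv_eq_iterate, Function.iterate_add_apply]

namespace HasWeakDeriv

variable {Ω Ω' : Set ℝ} {j k : ℕ} {u v w : ℝ → ℂ} {c d : ℝ}

theorem integral_eq_of_isTestFunction (h : HasWeakDeriv Ω k u v) {φ : ℝ → ℝ}
    (hφ : IsTestFunction Ω φ) :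
    ∫ x in Ω, iteratedDeriv k φ x • u x = (-1 : ℂ) ^ k * ∫ x in Ω, φ x • v x :=
  h.integral_eq φ hφ.contDiff hφ.hasCompactSupport hφ.tsupport_subset

theorem mono (hΩ : MeasurableSet Ω) (h : HasWeakDeriv Ω k u v) (hsub : Ω' ⊆ Ω) :
    HasWeakDeriv Ω' k u v where
  locInt := h.locInt.mono_set hsub
  locInt' := h.locInt'.mono_set hsub
  integral_eq φ hsmooth hcompact hsupp := by
    have hφ : IsTestFunction Ω' φ := ⟨hsmooth, hcompact, hsupp⟩
    rw [← (hφ.iteratedDeriv k).setIntegral_smul_of_subset hΩ hsub,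
      ← hφ.setIntegral_smul_of_subset hΩ hsub]
    exact h.integral_eq_of_isTestFunction (hφ.mono hsub)

theorem self (hu : LocallyIntegrableOn u Ω) : HasWeakDeriv Ω 0 u u :=
  ⟨hu, hu, fun φ _ _ _ => by rw [iteratedDeriv_zero, pow_zero, one_mul]⟩

theorem comp (h : HasWeakDeriv Ω j u v) (h' : HasWeakDeriv Ω k v w) :
    HasWeakDeriv Ω (j + k) u w where
  locInt := h.locInt
  locInt' := h'.locInt'
  integral_eq φ hsmooth hcompact hsupp := by
    have hφ : IsTestFunction Ω φ := ⟨hsmooth, hcompact, hsupp⟩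
    rw [← iteratedDeriv_iteratedDeriv, h.integral_eq_of_isTestFunction (hφ.iteratedDeriv k),
      h'.integral_eq_of_isTestFunction hφ, pow_add, mul_assoc]

theorem of_comp (h : HasWeakDeriv Ω j u v) (h' : HasWeakDeriv Ω (j + k) u w) :
    HasWeakDeriv Ω k v w where
  locInt := h.locInt'
  locInt' := h'.locInt'
  integral_eq φ hsmooth hcompact hsupp := by
    have hφ : IsTestFunction Ω φ := ⟨hsmooth, hcompact, hsupp⟩
    have heq := h.integral_eq_of_isTestFunction (hφ.iteratedDeriv k)
    rw [iteratedDeriv_iteratedDeriv, h'.integral_eq_of_isTestFunction hφ, pow_add,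
      mul_assoc] at heq
    exact (mul_left_cancel₀ (pow_ne_zero j (by norm_num)) heq).symm

theorem congr_right (h : HasWeakDeriv Ω k u v) (hvw : v =ᵐ[volume.restrict Ω] w) :
    HasWeakDeriv Ω k u w :=
  h.congr (Filter.EventuallyEq.refl _ _) hvw

theorem ae_eq (hΩ : IsOpen Ω) (h : HasWeakDeriv Ω k u v) (h' : HasWeakDeriv Ω k u w) :
    v =ᵐ[volume.restrict Ω] w :=
  (ae_restrict_iff' hΩ.measurableSet).2 (h.ae_unique hΩ h')

theorem setIntegral_smul_eq_zero (h : HasWeakDeriv (Ioo c d) 1 u fun _ => 0) {ψ : ℝ → ℝ}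
    (hψ : IsTestFunction (Ioo c d) ψ) (hint : ∫ x, ψ x = 0) :
    ∫ x in Ioo c d, ψ x • u x = 0 := by
  obtain ⟨Ψ, hΨ, rfl⟩ := hψ.exists_deriv_eq hint
  simpa only [iteratedDeriv_one, smul_zero, integral_zero, mul_zero] using
    h.integral_eq_of_isTestFunction hΨ

-- The constant is `∫ η u` for a unit-mass test function `η`: every test function `φ` is the sum
-- of `(∫ φ) η` and of a test function of integral zero.
theorem exists_ae_eq_const (hcd : c < d) (h : HasWeakDeriv (Ioo c d) 1 u fun _ => 0) :
    ∃ C : ℂ, u =ᵐ[volume.restrict (Ioo c d)] fun _ => C := by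
  obtain ⟨η, hη, hη_int⟩ :=
    exists_isTestFunction_integral_eq_one isOpen_Ioo (nonempty_Ioo.2 hcd)
  refine ⟨∫ x in Ioo c d, η x • u x, (self h.locInt).ae_eq isOpen_Ioo
    ⟨h.locInt, continuousOn_const.locallyIntegrableOn measurableSet_Ioo, ?_⟩⟩
  intro φ hsmooth hcompact hsupp
  have hφ : IsTestFunction (Ioo c d) φ := ⟨hsmooth, hcompact, hsupp⟩
  have hzero := h.setIntegral_smul_eq_zero (hφ.sub_const_mul hη (∫ x, φ x)) (by
    rw [integral_sub hφ.integrable (hη.integrable.const_mul _), integral_const_mul, hη_int,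
      mul_one, sub_self])
  simp only [sub_smul, mul_smul] at hzero
  have hη_integrable : IntegrableOn (fun x => (∫ x, φ x) • η x • u x) (Ioo c d) :=
    (hη.integrableOn_smul isOpen_Ioo h.locInt).fun_smul _
  rw [integral_sub (hφ.integrableOn_smul isOpen_Ioo h.locInt) hη_integrable,
    integral_smul, sub_eq_zero] at hzero
  rw [iteratedDeriv_zero, pow_zero, one_mul, hφ.setIntegral_smul_const, hzero]

end HasWeakDeriv

theorem IsPrimitive.hasWeakDeriv {c d : ℝ} {F f : ℝ → ℂ} (h : IsPrimitive c d F f) :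
    HasWeakDeriv (Ioo c d) 1 F f where
  locInt := (h.continuousOn.mono Ioo_subset_Icc_self).locallyIntegrableOn measurableSet_Ioo
  locInt' := ((intervalIntegrable_iff_integrableOn_Ioo_of_le h.le).1
    h.intervalIntegrable).locallyIntegrableOn
  integral_eq φ hsmooth hcompact hsupp := by
    have hφ : IsTestFunction (Ioo c d) φ := ⟨hsmooth, hcompact, hsupp⟩
    have hφ_prim : IsPrimitive c d (fun x => (φ x : ℂ)) (fun x => ((deriv φ x : ℝ) : ℂ)) :=
      .of_hasDerivAt h.le
        (fun x => (hsmooth.differentiable (by simp) x).hasDerivAt.ofReal_comp)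
        (Complex.continuous_ofReal.comp (hsmooth.continuous_deriv (by simp)))
    have hparts := hφ_prim.integral_mul_eq_sub h
    simp only [hφ.eq_zero_of_notMem left_notMem_Ioo, hφ.eq_zero_of_notMem right_notMem_Ioo,
      Complex.ofReal_zero, zero_mul, sub_zero, zero_sub, intervalIntegral.integral_of_le h.le,
      integral_Ioc_eq_integral_Ioo] at hparts
    simp only [iteratedDeriv_one, Complex.real_smul, hparts, pow_one, neg_mul, one_mul, neg_neg]

theorem HasWeakDeriv.exists_isPrimitive {c d : ℝ} (hcd : c < d) {u w : ℝ → ℂ}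
    (h : HasWeakDeriv (Ioo c d) 1 u w) (hw : IntegrableOn w (Ioo c d)) :
    ∃ F : ℝ → ℂ, IsPrimitive c d F w ∧ u =ᵐ[volume.restrict (Ioo c d)] F := by
  have hprim := IsPrimitive.of_intervalIntegrable hcd.le
    ((intervalIntegrable_iff_integrableOn_Ioo_of_le hcd.le).2 hw)
  obtain ⟨C, hC⟩ := ((h.add isOpen_Ioo ((hprim 0).hasWeakDeriv.smul (-1))).congr_right
    (w := fun _ => 0) (by filter_upwards with x; ring)).exists_ae_eq_const hcd
  refine ⟨_, hprim C, ?_⟩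
  filter_upwards [hC] with x hx
  linear_combination hx

/-! ### Wirtinger's inequality and Green's identity -/

theorem eqOn_Icc_of_ae_eq {E : Type*} [TopologicalSpace E] [T2Space E] {c d : ℝ} (hcd : c < d)
    {f g : ℝ → E} (hf : ContinuousOn f (Icc c d)) (hg : ContinuousOn g (Icc c d))
    (h : f =ᵐ[volume.restrict (Ioo c d)] g) : EqOn f g (Icc c d) :=
  (Measure.eqOn_open_of_ae_eq h isOpen_Ioo (hf.mono Ioo_subset_Icc_self)
    (hg.mono Ioo_subset_Icc_self)).of_subset_closure hf hg Ioo_subset_Icc_self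
      (closure_Ioo hcd.ne).ge

theorem two_div_pi_mul_min_le_sin {x : ℝ} (h0 : 0 ≤ x) (hπ : x ≤ Real.pi) :
    2 / Real.pi * min x (Real.pi - x) ≤ Real.sin x := by
  rcases le_total x (Real.pi / 2) with hx | hx
  · exact (mul_le_mul_of_nonneg_left (min_le_left _ _) (by positivity)).trans
      (Real.mul_le_sin h0 hx)
  · rw [← Real.sin_pi_sub]
    exact (mul_le_mul_of_nonneg_left (min_le_right _ _) (by positivity)).trans
      (Real.mul_le_sin (by linarith) (by linarith))

theorem IsPrimitive.norm_le_mul_min {E : Type*} [NormedAddCommGroup E] [NormedSpace ℝ E]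
    {c d M : ℝ} {F f : ℝ → E} (h : IsPrimitive c d F f) (hM : ∀ x ∈ Icc c d, ‖f x‖ ≤ M)
    (hFc : F c = 0) (hFd : F d = 0) {x : ℝ} (hx : x ∈ Icc c d) :
    ‖F x‖ ≤ M * min (x - c) (d - x) := by
  have hlip : ∀ y ∈ Icc c d, ∀ z ∈ Icc c d, ‖F z - F y‖ ≤ M * |z - y| := fun y hy z hz => by
    rw [h.sub_eq_integral hy hz]
    exact intervalIntegral.norm_integral_le_of_norm_le_const fun t ht =>
      hM t (ordConnected_Icc.uIcc_subset hy hz (uIoc_subset_uIcc ht))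
  rcases min_choice (x - c) (d - x) with hmin | hmin <;> rw [hmin]
  · simpa only [hFc, sub_zero, abs_of_nonneg (sub_nonneg.2 hx.1)] using
      hlip c (left_mem_Icc.2 h.le) x hx
  · simpa only [hFd, zero_sub, norm_neg, abs_of_nonneg (sub_nonneg.2 hx.2)] using
      hlip x hx d (right_mem_Icc.2 h.le)

section Wirtinger

variable {E : Type*} [NormedAddCommGroup E] {c d κ M x : ℝ} {F f : ℝ → E}

/-- The function `κ cot(κ (x - c)) ‖F x‖²`, whose derivative completes the square in Wirtinger's
inequality. At a zero of the sine the quotient is `0` by convention. -/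
noncomputable def cotNormSq (κ c : ℝ) (F : ℝ → E) (x : ℝ) : ℝ :=
  κ * (Real.cos (κ * (x - c)) / Real.sin (κ * (x - c))) * ‖F x‖ ^ 2

theorem two_div_pi_mul_le_sin (hκ : 0 < κ) (hκπ : κ * (d - c) = Real.pi) (hx : x ∈ Icc c d) :
    2 / Real.pi * (κ * min (x - c) (d - x)) ≤ Real.sin (κ * (x - c)) := by
  have hmin : κ * min (x - c) (d - x) = min (κ * (x - c)) (Real.pi - κ * (x - c)) := by
    rw [mul_min_of_nonneg _ _ hκ.le, ← hκπ]
    ring_nf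
  rw [hmin]
  refine two_div_pi_mul_min_le_sin (mul_nonneg hκ.le (sub_nonneg.2 hx.1)) ?_
  rw [← hκπ]
  gcongr
  exact hx.2

theorem sin_pos_of_mem_Ioo (hκ : 0 < κ) (hκπ : κ * (d - c) = Real.pi) (hx : x ∈ Ioo c d) :
    0 < Real.sin (κ * (x - c)) := by
  have hmin : 0 < min (x - c) (d - x) := lt_min (sub_pos.2 hx.1) (sub_pos.2 hx.2)
  exact lt_of_lt_of_le (by positivity)
    (two_div_pi_mul_le_sin hκ hκπ (Ioo_subset_Icc_self hx))

theorem abs_cotNormSq_le (hκ : 0 < κ) (hκπ : κ * (d - c) = Real.pi)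
    (hF : ‖F x‖ ≤ M * min (x - c) (d - x)) (hx : x ∈ Icc c d) :
    |cotNormSq κ c F x| ≤ Real.pi / 2 * M ^ 2 * min (x - c) (d - x) := by
  have hsin := two_div_pi_mul_le_sin hκ hκπ hx
  have hmin : 0 ≤ min (x - c) (d - x) := le_min (sub_nonneg.2 hx.1) (sub_nonneg.2 hx.2)
  unfold cotNormSq
  set m := min (x - c) (d - x)
  rcases hmin.eq_or_lt with hm | hm
  · rw [← hm, mul_zero, norm_le_zero_iff] at hF
    rw [hF, ← hm, norm_zero, zero_pow two_ne_zero, mul_zero, mul_zero, abs_zero]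
  have hcot : |Real.cos (κ * (x - c)) / Real.sin (κ * (x - c))|
      ≤ 1 / (2 / Real.pi * (κ * m)) := by
    rw [abs_div, abs_of_pos ((by positivity : 0 < 2 / Real.pi * (κ * m)).trans_le hsin)]
    exact div_le_div₀ zero_le_one (Real.abs_cos_le_one _) (by positivity) hsin
  rw [abs_mul, abs_mul, abs_of_pos hκ, abs_of_nonneg (sq_nonneg ‖F x‖)]
  calc κ * |Real.cos (κ * (x - c)) / Real.sin (κ * (x - c))| * ‖F x‖ ^ 2
      ≤ κ * (1 / (2 / Real.pi * (κ * m))) * (M * m) ^ 2 := by gcongr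
    _ = Real.pi / 2 * M ^ 2 * m := by field_simp

theorem continuousOn_cotNormSq (hκ : 0 < κ) (hκπ : κ * (d - c) = Real.pi)
    (hF : ∀ x ∈ Icc c d, ‖F x‖ ≤ M * min (x - c) (d - x))
    (hcont : ∀ x ∈ Ioo c d, ContinuousAt (cotNormSq κ c F) x) :
    ContinuousOn (cotNormSq κ c F) (Icc c d) := by
  intro x hx
  by_cases hmin : min (x - c) (d - x) = 0
  · have hbound := fun y hy => abs_cotNormSq_le hκ hκπ (hF y hy) hy
    have hzero : cotNormSq κ c F x = 0 := by
      rw [← abs_nonpos_iff]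
      simpa only [hmin, mul_zero] using hbound x hx
    have hlim : Filter.Tendsto (fun y => Real.pi / 2 * M ^ 2 * min (y - c) (d - y))
        (nhdsWithin x (Icc c d)) (nhds (Real.pi / 2 * M ^ 2 * min (x - c) (d - x))) :=
      (by fun_prop : Continuous fun y => Real.pi / 2 * M ^ 2 * min (y - c) (d - y)).tendsto x
        |>.mono_left nhdsWithin_le_nhds
    rw [hmin, mul_zero] at hlim
    rw [ContinuousWithinAt, hzero]
    exact squeeze_zero_norm' (by filter_upwards [self_mem_nhdsWithin] with y hy using hbound y hy)
      hlim
  · have hpos : 0 < min (x - c) (d - x) :=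
      (le_min (sub_nonneg.2 hx.1) (sub_nonneg.2 hx.2)).lt_of_ne' hmin
    rw [lt_min_iff, sub_pos, sub_pos] at hpos
    exact (hcont x hpos).continuousWithinAt

variable [InnerProductSpace ℝ E]

theorem hasDerivAt_cotNormSq (hsin : Real.sin (κ * (x - c)) ≠ 0) (hF : HasDerivAt F (f x) x) :
    HasDerivAt (cotNormSq κ c F) (‖f x‖ ^ 2 - κ ^ 2 * ‖F x‖ ^ 2
      - ‖f x - (κ * (Real.cos (κ * (x - c)) / Real.sin (κ * (x - c)))) • F x‖ ^ 2) x := by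
  have hlin : HasDerivAt (fun y => κ * (y - c)) κ x := by
    simpa only [mul_one] using ((hasDerivAt_id' x).sub_const c).const_mul κ
  refine (((hlin.cos.div hlin.sin hsin).const_mul κ).mul hF.norm_sq).congr_deriv ?_
  rw [norm_sub_sq_real, norm_smul, real_inner_smul_right, real_inner_comm (F x)]
  simp only [Real.norm_eq_abs, mul_pow, sq_abs, Pi.div_apply]
  field_simp
  ring

variable [CompleteSpace E]

-- The derivative of `∫ (‖f‖² - κ² ‖F‖²) - cotNormSq κ c F` is a square, and `cotNormSq` vanishes at
-- both ends of the interval.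
theorem wirtinger_inequality (hcd : c < d) (h : IsPrimitive c d F f)
    (hf : ContinuousOn f (Icc c d)) (hFc : F c = 0) (hFd : F d = 0) :
    (Real.pi / (d - c)) ^ 2 * ∫ x in c..d, ‖F x‖ ^ 2 ≤ ∫ x in c..d, ‖f x‖ ^ 2 := by
  have hlen : 0 < d - c := sub_pos.2 hcd
  set κ := Real.pi / (d - c)
  have hκ : 0 < κ := div_pos Real.pi_pos hlen
  have hκπ : κ * (d - c) = Real.pi := div_mul_cancel₀ _ hlen.ne'
  obtain ⟨M, hM⟩ := isCompact_Icc.exists_bound_of_continuousOn hf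
  have hF_le := fun x hx => h.norm_le_mul_min (x := x) hM hFc hFd hx
  have hF_sq : ContinuousOn (fun x => κ ^ 2 * ‖F x‖ ^ 2) (Icc c d) :=
    continuousOn_const.mul (h.continuousOn.norm.pow 2)
  have hf_sq : ContinuousOn (fun x => ‖f x‖ ^ 2) (Icc c d) := hf.norm.pow 2
  have hK := IsPrimitive.of_intervalIntegrable hcd.le
    ((hf_sq.intervalIntegrable_of_Icc (μ := volume) hcd.le).sub
      (hF_sq.intervalIntegrable_of_Icc hcd.le)) 0
  have hcot := fun x (hx : x ∈ Ioo c d) =>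
    hasDerivAt_cotNormSq (sin_pos_of_mem_Ioo hκ hκπ hx).ne' (h.hasDerivAt hf hx)
  have hderiv := fun x (hx : x ∈ Ioo c d) =>
    (hK.hasDerivAt (hf_sq.sub hF_sq) hx).sub (hcot x hx)
  have hmono := monotoneOn_of_deriv_nonneg (convex_Icc c d)
    (hK.continuousOn.sub (continuousOn_cotNormSq hκ hκπ hF_le fun x hx => (hcot x hx).continuousAt))
    (fun x hx => (hderiv x (by rwa [interior_Icc] at hx)).differentiableAt.differentiableWithinAt)
    (fun x hx => by
      rw [(hderiv x (by rwa [interior_Icc] at hx)).deriv, sub_sub_cancel]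
      positivity)
  have hle := hmono (left_mem_Icc.2 hcd.le) (right_mem_Icc.2 hcd.le) hcd.le
  simp only [Pi.sub_apply, cotNormSq, hFc, hFd, norm_zero, ne_eq, OfNat.ofNat_ne_zero,
    not_false_eq_true, zero_pow, mul_zero, sub_zero, zero_add, intervalIntegral.integral_same]
    at hle
  rwa [intervalIntegral.integral_sub (hf_sq.intervalIntegrable_of_Icc hcd.le)
    (hF_sq.intervalIntegrable_of_Icc hcd.le), intervalIntegral.integral_const_mul,
    sub_nonneg] at hle

end Wirtinger

theorem sq_integral_le_mul_integral_sq {c d : ℝ} {f : ℝ → ℝ} (hcd : c ≤ d)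
    (hf : IntervalIntegrable f volume c d)
    (hf_sq : IntervalIntegrable (fun x => f x ^ 2) volume c d) :
    (∫ x in c..d, f x) ^ 2 ≤ (d - c) * ∫ x in c..d, f x ^ 2 := by
  rcases hcd.eq_or_lt with rfl | hlt
  · simp only [intervalIntegral.integral_same, sub_self, zero_mul, ne_eq, OfNat.ofNat_ne_zero,
      not_false_eq_true, zero_pow, le_refl]
  have hlen : 0 < d - c := sub_pos.2 hlt
  have hjensen := (even_two.convexOn_pow (𝕜 := ℝ)).map_set_average_le (μ := volume)
    (t := Ioc c d) (f := f) (continuous_pow 2).continuousOn isClosed_univ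
    (by simp [hlt]) measure_Ioc_lt_top.ne (Filter.Eventually.of_forall fun _ => mem_univ _)
    hf.1 hf_sq.1
  rw [← uIoc_of_le hcd, interval_average_eq_div, interval_average_eq_div, div_pow,
    div_le_div_iff₀ (by positivity) hlen] at hjensen
  refine le_of_mul_le_mul_right (hjensen.trans_eq ?_) hlen
  ring

theorem IsPrimitive.sq_norm_le_mul_integral {E : Type*} [NormedAddCommGroup E] [NormedSpace ℝ E]
    {c d x : ℝ} {F f : ℝ → E} (h : IsPrimitive c d F f) (hf : ContinuousOn f (Icc c d))
    (hFc : F c = 0) (hx : x ∈ Icc c d) : ‖F x‖ ^ 2 ≤ (d - c) * ∫ t in c..d, ‖f t‖ ^ 2 := by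
  have h_int : IntervalIntegrable (fun t => ‖f t‖) volume c d := h.intervalIntegrable.norm
  have h_norm : ‖F x‖ ≤ ∫ t in c..d, ‖f t‖ :=
    calc ‖F x‖ = ‖∫ t in c..x, f t‖ := by rw [h.eq_add_integral x hx, hFc, zero_add]
      _ ≤ ∫ t in c..x, ‖f t‖ := intervalIntegral.norm_integral_le_integral_norm hx.1
      _ ≤ ∫ t in c..d, ‖f t‖ := intervalIntegral.integral_mono_interval le_rfl hx.1 hx.2
          (Filter.Eventually.of_forall fun _ => norm_nonneg _) h_int
  calc ‖F x‖ ^ 2 ≤ (∫ t in c..d, ‖f t‖) ^ 2 := by gcongr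
    _ ≤ (d - c) * ∫ t in c..d, ‖f t‖ ^ 2 := sq_integral_le_mul_integral_sq h.le h_int
        ((hf.norm.pow 2).intervalIntegrable_of_Icc h.le)

theorem IsPrimitive.green_identity {𝕜 : Type*} [RCLike 𝕜] {c d : ℝ} {F F' f G G' g : ℝ → 𝕜}
    (hF : IsPrimitive c d F F') (hF' : IsPrimitive c d F' f) (hG : IsPrimitive c d G G')
    (hG' : IsPrimitive c d G' g) :
    ∫ x in c..d, F x * g x = (∫ x in c..d, f x * G x)
      + (F d * G' d - F' d * G d) - (F c * G' c - F' c * G c) := by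
  have hparts := hF'.integral_mul_eq_sub hG
  rw [hF.integral_mul_eq_sub hG']
  linear_combination -hparts

/-! ### Sobolev functions and traces -/

namespace MemHk

variable {Ω Ω' : Set ℝ} {c d : ℝ} {j k n : ℕ} {u w : ℝ → ℂ}

theorem mono (hΩ : MeasurableSet Ω) (h : MemHk Ω n u) (hsub : Ω' ⊆ Ω) : MemHk Ω' n u :=
  fun j hj =>
    have ⟨w, hw, hweak⟩ := h j hj
    ⟨w, hw.mono_measure (Measure.restrict_mono hsub le_rfl), hweak.mono hΩ hsub⟩

theorem of_hasWeakDeriv (hu : MemHk Ω k u) (h : HasWeakDeriv Ω k u w) (hw : MemHk Ω n w) :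
    MemHk Ω (k + n) u := by
  intro j hj
  rcases le_total j k with hjk | hkj
  · exact hu j hjk
  · obtain ⟨i, rfl⟩ := Nat.exists_eq_add_of_le hkj
    obtain ⟨v, hv, hweak⟩ := hw i (Nat.add_le_add_iff_left.1 hj)
    exact ⟨v, hv, h.comp hweak⟩

theorem exists_isPrimitive (hcd : c < d) (h : MemHk (Ioo c d) n u) (hj : j < n)
    (hw : HasWeakDeriv (Ioo c d) (j + 1) u w) (hw_int : IntegrableOn w (Ioo c d)) :
    ∃ F : ℝ → ℂ, IsPrimitive c d F w ∧ HasWeakDeriv (Ioo c d) j u F := by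
  obtain ⟨v, -, hv⟩ := h j hj.le
  obtain ⟨F, hF, hvF⟩ := (hv.of_comp hw).exists_isPrimitive hcd hw_int
  exact ⟨F, hF, hv.congr_right hvF⟩

theorem exists_isPrimitive_isPrimitive (hcd : c < d) (h : MemHk (Ioo c d) n u) (hj : j + 1 < n)
    (hw : HasWeakDeriv (Ioo c d) (j + 2) u w) (hw_int : IntegrableOn w (Ioo c d)) :
    ∃ F F' : ℝ → ℂ, IsPrimitive c d F F' ∧ IsPrimitive c d F' w ∧
      HasWeakDeriv (Ioo c d) j u F ∧ HasWeakDeriv (Ioo c d) (j + 1) u F' := by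
  obtain ⟨F', hF', hweak'⟩ := h.exists_isPrimitive hcd hj hw hw_int
  obtain ⟨F, hF, hweak⟩ := h.exists_isPrimitive hcd ((Nat.lt_succ_self j).trans hj) hweak'
    ((hF'.continuousOn.integrableOn_compact isCompact_Icc).mono_set Ioo_subset_Icc_self)
  exact ⟨F, F', hF, hF', hweak, hweak'⟩

theorem exists_hasTrace (hcd : c < d) (h : MemHk (Ioo c d) n u) (hj : j < n) (x : ℝ) :
    ∃ y, HasTrace c d j u x y := by
  obtain ⟨w, hw, hweak⟩ := h (j + 1) hj
  obtain ⟨F, hF, hweakF⟩ := h.exists_isPrimitive hcd hj hweak (hw.integrable one_le_two)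
  exact ⟨F x, F, hF.continuousOn, hweakF, rfl⟩

end MemHk

namespace HasTrace

variable {c d c' d' x : ℝ} {j k : ℕ} {u w F : ℝ → ℂ} {y y' : ℂ}

theorem eq_of_hasWeakDeriv (hcd : c < d) (h : HasTrace c d j u x y)
    (hF : HasWeakDeriv (Ioo c d) j u F) (hF_cont : ContinuousOn F (Icc c d))
    (hx : x ∈ Icc c d) : F x = y := by
  obtain ⟨g, hg_cont, hg, rfl⟩ := h
  exact eqOn_Icc_of_ae_eq hcd hF_cont hg_cont (hF.ae_eq isOpen_Ioo hg) hx

theorem unique (hcd : c < d) (h : HasTrace c d j u x y) (h' : HasTrace c d j u x y')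
    (hx : x ∈ Icc c d) : y = y' := by
  obtain ⟨g, hg_cont, hg, rfl⟩ := h
  exact h'.eq_of_hasWeakDeriv hcd hg hg_cont hx

theorem mono (h : HasTrace c d j u x y) (hc : c ≤ c') (hd : d' ≤ d) :
    HasTrace c' d' j u x y := by
  obtain ⟨g, hg_cont, hg, hy⟩ := h
  exact ⟨g, hg_cont.mono (Icc_subset_Icc hc hd),
    hg.mono measurableSet_Ioo (Ioo_subset_Ioo hc hd), hy⟩

theorem of_hasWeakDeriv (hu : HasWeakDeriv (Ioo c d) j u w) (h : HasTrace c d k w x y) :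
    HasTrace c d (j + k) u x y := by
  obtain ⟨g, hg_cont, hg, hy⟩ := h
  exact ⟨g, hg_cont, hu.comp hg, hy⟩

end HasTrace

theorem memLp_restrict_Ioo_of_continuousOn {E : Type*} [NormedAddCommGroup E] {c d : ℝ}
    {F : ℝ → E} (hF : ContinuousOn F (Icc c d)) (p : ENNReal) :
    MemLp F p (volume.restrict (Ioo c d)) := by
  obtain ⟨M, hM⟩ := isCompact_Icc.exists_bound_of_continuousOn hF
  refine MemLp.of_bound ((hF.mono Ioo_subset_Icc_self).aestronglyMeasurable measurableSet_Ioo) M ?_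
  filter_upwards [ae_restrict_mem measurableSet_Ioo] with x hx using hM x (Ioo_subset_Icc_self hx)

theorem integral_conj_mul_self (F : ℝ → ℂ) (c d : ℝ) :
    ∫ x in c..d, starRingEnd ℂ (F x) * F x = ((∫ x in c..d, ‖F x‖ ^ 2 : ℝ) : ℂ) := by
  simp only [Complex.conj_mul', ← intervalIntegral.integral_ofReal, Complex.ofReal_pow]

namespace L2I

variable {u v : L2I} {F G : ℝ → ℂ}

theorem integrableOn (u : L2I) : IntegrableOn u (Ioo 0 1) :=
  (Lp.memLp u).integrable one_le_two

theorem inner_eq_integral (hu : u =ᵐ[volume.restrict (Ioo 0 1)] F)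
    (hv : v =ᵐ[volume.restrict (Ioo 0 1)] G) :
    inner ℂ u v = ∫ x in (0 : ℝ)..1, starRingEnd ℂ (F x) * G x := by
  rw [L2.inner_def, intervalIntegral.integral_of_le zero_le_one, integral_Ioc_eq_integral_Ioo]
  refine integral_congr_ae ?_
  filter_upwards [hu, hv] with x hux hvx
  rw [hux, hvx, RCLike.inner_apply, mul_comm]

theorem inner_eq_integral_add_integral {ξ : ℝ} (hξ : ξ ∈ Ioo (0 : ℝ) 1)
    (hu : u =ᵐ[volume.restrict (Ioo 0 1)] F) (hv : v =ᵐ[volume.restrict (Ioo 0 1)] G) :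
    inner ℂ u v = (∫ x in (0 : ℝ)..ξ, starRingEnd ℂ (F x) * G x)
      + ∫ x in ξ..1, starRingEnd ℂ (F x) * G x := by
  have h_int : IntegrableOn (fun x => starRingEnd ℂ (F x) * G x) (Ioo 0 1) := by
    refine (L2.integrable_inner (𝕜 := ℂ) u v).congr ?_
    filter_upwards [hu, hv] with x hux hvx
    rw [hux, hvx, RCLike.inner_apply, mul_comm]
  rw [inner_eq_integral hu hv, intervalIntegral.integral_add_adjacent_intervals
    ((intervalIntegrable_iff_integrableOn_Ioo_of_le hξ.1.le).2
      (h_int.mono_set (left_subset hξ)))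
    ((intervalIntegrable_iff_integrableOn_Ioo_of_le hξ.2.le).2
      (h_int.mono_set (right_subset hξ)))]

theorem norm_sq_eq_integral (hu : u =ᵐ[volume.restrict (Ioo 0 1)] F) :
    ‖u‖ ^ 2 = ∫ x in (0 : ℝ)..1, ‖F x‖ ^ 2 := by
  rw [← inner_self_eq_norm_sq (𝕜 := ℂ), inner_eq_integral hu hu, integral_conj_mul_self]
  exact Complex.ofReal_re _

end L2I

theorem HasWeakDeriv.ae_eq_of_order_zero {Ω : Set ℝ} {u v : ℝ → ℂ} (hΩ : IsOpen Ω)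
    (h : HasWeakDeriv Ω 0 u v) : u =ᵐ[volume.restrict Ω] v :=
  (HasWeakDeriv.self h.locInt).ae_eq hΩ h

theorem IsPrimitive.integral_conj_mul_eq_neg {c d : ℝ} {F F' f : ℝ → ℂ}
    (hF : IsPrimitive c d F F') (hF' : IsPrimitive c d F' f) (hFc : F c = 0) (hFd : F d = 0) :
    ∫ x in c..d, starRingEnd ℂ (F x) * f x = -((∫ x in c..d, ‖F' x‖ ^ 2 : ℝ) : ℂ) := by
  rw [hF.conj.integral_mul_eq_sub hF', integral_conj_mul_self, hFc, hFd, map_zero, zero_mul,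
    zero_mul, sub_self, zero_sub]

/-! ### The Dirichlet problem -/

/-- `u` solves the Dirichlet problem `u'' = f` on `(0, 1)`, `u(0) = u(1) = 0`. -/
structure IsDirichletSol (u f : L2I) : Prop where
  weak : HasWeakDeriv (Ioo 0 1) 2 u f
  memH2 : MemHk (Ioo 0 1) 2 u
  zero : HasTrace 0 1 0 u 0 0
  one : HasTrace 0 1 0 u 1 0

namespace IsDirichletSol

variable {u v f g : L2I}

theorem exists_isPrimitive_isPrimitive (h : IsDirichletSol u f) :
    ∃ F F' : ℝ → ℂ, IsPrimitive 0 1 F F' ∧ IsPrimitive 0 1 F' f ∧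
      HasWeakDeriv (Ioo 0 1) 0 u F ∧ F 0 = 0 ∧ F 1 = 0 := by
  obtain ⟨F, F', hF, hF', hweak, -⟩ :=
    h.memH2.exists_isPrimitive_isPrimitive zero_lt_one one_lt_two h.weak f.integrableOn
  exact ⟨F, F', hF, hF', hweak,
    h.zero.eq_of_hasWeakDeriv zero_lt_one hweak hF.continuousOn (left_mem_Icc.2 zero_le_one),
    h.one.eq_of_hasWeakDeriv zero_lt_one hweak hF.continuousOn (right_mem_Icc.2 zero_le_one)⟩

theorem of_isPrimitive {F F' : ℝ → ℂ} (hF : IsPrimitive 0 1 F F') (hF' : IsPrimitive 0 1 F' f)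
    (hF0 : F 0 = 0) (hF1 : F 1 = 0) (hu : u =ᵐ[volume.restrict (Ioo 0 1)] F) :
    IsDirichletSol u f := by
  have hweak₀ : HasWeakDeriv (Ioo 0 1) 0 u F :=
    (HasWeakDeriv.self u.integrableOn.locallyIntegrableOn).congr_right hu
  have hweak₁ := hweak₀.comp hF.hasWeakDeriv
  have hweak₂ := hweak₁.comp hF'.hasWeakDeriv
  refine ⟨hweak₂, fun j hj => ?_, ⟨F, hF.continuousOn, hweak₀, hF0⟩,
    ⟨F, hF.continuousOn, hweak₀, hF1⟩⟩
  interval_cases j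
  · exact ⟨F, memLp_restrict_Ioo_of_continuousOn hF.continuousOn 2, hweak₀⟩
  · exact ⟨F', memLp_restrict_Ioo_of_continuousOn hF'.continuousOn 2, hweak₁⟩
  · exact ⟨f, Lp.memLp f, hweak₂⟩

theorem exists_sol (f : L2I) : ∃ u, IsDirichletSol u f := by
  have hf : IntervalIntegrable f volume 0 1 :=
    (intervalIntegrable_iff_integrableOn_Ioo_of_le zero_le_one).2 f.integrableOn
  have hslope := IsPrimitive.of_intervalIntegrable zero_le_one hf
  have hslope_int : ∀ C : ℂ, IntervalIntegrable (fun x => C + ∫ t in (0 : ℝ)..x, f t) volume 0 1 :=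
    fun C => (hslope C).continuousOn.intervalIntegrable_of_Icc zero_le_one
  -- The initial slope is chosen so that the mean of `u'` vanishes, which makes `u(1) = u(0)`.
  obtain ⟨C, hC⟩ : ∃ C : ℂ, ∫ x in (0 : ℝ)..1, (C + ∫ t in (0 : ℝ)..x, f t) = 0 := by
    refine ⟨-∫ x in (0 : ℝ)..1, ∫ t in (0 : ℝ)..x, f t, ?_⟩
    rw [intervalIntegral.integral_add intervalIntegrable_const
      (by simpa only [zero_add] using hslope_int 0), intervalIntegral.integral_const, sub_zero,
      one_smul, neg_add_cancel]
  have hF := IsPrimitive.of_intervalIntegrable zero_le_one (hslope_int C) 0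
  have hF_memLp := memLp_restrict_Ioo_of_continuousOn hF.continuousOn 2
  exact ⟨hF_memLp.toLp _, of_isPrimitive hF (hslope C) (by simp) (by simp [hC])
    hF_memLp.coeFn_toLp⟩

theorem add (hu : IsDirichletSol u f) (hv : IsDirichletSol v g) :
    IsDirichletSol (u + v) (f + g) := by
  have h_coe := L2I.coe_add (le_refl (Ioo (0 : ℝ) 1)) u v
  exact ⟨(hu.weak.add isOpen_Ioo hv.weak).congr h_coe (L2I.coe_add le_rfl f g),
    (hu.memH2.add isOpen_Ioo hv.memH2).congr h_coe,
    by simpa only [add_zero] using (hu.zero.add hv.zero).congr h_coe,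
    by simpa only [add_zero] using (hu.one.add hv.one).congr h_coe⟩

theorem smul (c : ℂ) (h : IsDirichletSol u f) : IsDirichletSol (c • u) (c • f) := by
  have h_coe := L2I.coe_smul (le_refl (Ioo (0 : ℝ) 1)) c u
  exact ⟨(h.weak.smul c).congr h_coe (L2I.coe_smul le_rfl c f), (h.memH2.smul c).congr h_coe,
    by simpa only [mul_zero] using (h.zero.smul c).congr h_coe,
    by simpa only [mul_zero] using (h.one.smul c).congr h_coe⟩

theorem sub (hu : IsDirichletSol u f) (hv : IsDirichletSol v g) :
    IsDirichletSol (u - v) (f - g) := by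
  simpa only [neg_one_smul, ← sub_eq_add_neg] using hu.add (hv.smul (-1))

theorem inner_symm (hu : IsDirichletSol u f) (hv : IsDirichletSol v g) :
    inner ℂ f v = inner ℂ u g := by
  obtain ⟨F, F', hF, hF', huF, hF0, hF1⟩ := hu.exists_isPrimitive_isPrimitive
  obtain ⟨G, G', hG, hG', hvG, hG0, hG1⟩ := hv.exists_isPrimitive_isPrimitive
  have hgreen := hF.conj.green_identity hF'.conj hG hG'
  rw [L2I.inner_eq_integral .rfl (hvG.ae_eq_of_order_zero isOpen_Ioo),
    L2I.inner_eq_integral (huF.ae_eq_of_order_zero isOpen_Ioo) .rfl, hgreen]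
  simp only [hF0, hF1, hG0, hG1, map_zero, zero_mul, mul_zero, sub_self, add_zero, sub_zero]

theorem integral_norm_sq_le {F F' : ℝ → ℂ} (hF : IsPrimitive 0 1 F F')
    (hF' : IsPrimitive 0 1 F' f) (hu : u =ᵐ[volume.restrict (Ioo 0 1)] F) (hF0 : F 0 = 0)
    (hF1 : F 1 = 0) : ∫ x in (0 : ℝ)..1, ‖F' x‖ ^ 2 ≤ ‖f‖ * ‖u‖ := by
  have hinner : inner ℂ u f = -((∫ x in (0 : ℝ)..1, ‖F' x‖ ^ 2 : ℝ) : ℂ) := by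
    rw [L2I.inner_eq_integral hu .rfl, hF.integral_conj_mul_eq_neg hF' hF0 hF1]
  calc ∫ x in (0 : ℝ)..1, ‖F' x‖ ^ 2 ≤ |∫ x in (0 : ℝ)..1, ‖F' x‖ ^ 2| := le_abs_self _
    _ = ‖inner ℂ u f‖ := by rw [hinner, norm_neg, Complex.norm_real, Real.norm_eq_abs]
    _ ≤ ‖u‖ * ‖f‖ := norm_inner_le_norm u f
    _ = ‖f‖ * ‖u‖ := mul_comm _ _

theorem pi_sq_mul_norm_le (h : IsDirichletSol u f) : Real.pi ^ 2 * ‖u‖ ≤ ‖f‖ := by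
  obtain ⟨F, F', hF, hF', hweak, hF0, hF1⟩ := h.exists_isPrimitive_isPrimitive
  have huF := hweak.ae_eq_of_order_zero isOpen_Ioo
  have hwirtinger := wirtinger_inequality zero_lt_one hF hF'.continuousOn hF0 hF1
  rw [sub_zero, div_one, ← L2I.norm_sq_eq_integral huF] at hwirtinger
  rcases (norm_nonneg u).eq_or_lt with hu | hu
  · rw [← hu, mul_zero]
    exact norm_nonneg f
  · refine le_of_mul_le_mul_right ?_ hu
    calc Real.pi ^ 2 * ‖u‖ * ‖u‖ = Real.pi ^ 2 * ‖u‖ ^ 2 := by ring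
      _ ≤ ‖f‖ * ‖u‖ := hwirtinger.trans (integral_norm_sq_le hF hF' huF hF0 hF1)

theorem norm_le_norm (h : IsDirichletSol u f) : ‖u‖ ≤ ‖f‖ := by
  have hpi : 1 ≤ Real.pi ^ 2 := one_le_pow₀ (by linarith [Real.pi_gt_three])
  exact (le_mul_of_one_le_left (norm_nonneg u) hpi).trans h.pi_sq_mul_norm_le

theorem pi_pow_four_mul_norm_sq_le (h : IsDirichletSol u f) :
    Real.pi ^ 4 * ‖u‖ ^ 2 ≤ ‖f‖ ^ 2 :=
  calc Real.pi ^ 4 * ‖u‖ ^ 2 = (Real.pi ^ 2 * ‖u‖) ^ 2 := by ring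
    _ ≤ ‖f‖ ^ 2 := pow_le_pow_left₀ (by positivity) h.pi_sq_mul_norm_le 2

theorem norm_trace_le (h : IsDirichletSol u f) {x : ℝ} (hx : x ∈ Icc (0 : ℝ) 1) {y : ℂ}
    (hy : HasTrace 0 1 0 u x y) : ‖y‖ ≤ ‖f‖ := by
  obtain ⟨F, F', hF, hF', hweak, hF0, hF1⟩ := h.exists_isPrimitive_isPrimitive
  refine le_of_sq_le_sq ?_ (norm_nonneg f)
  calc ‖y‖ ^ 2 = ‖F x‖ ^ 2 := by rw [hy.eq_of_hasWeakDeriv zero_lt_one hweak hF.continuousOn hx]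
    _ ≤ (1 - 0) * ∫ t in (0 : ℝ)..1, ‖F' t‖ ^ 2 :=
      hF.sq_norm_le_mul_integral hF'.continuousOn hF0 hx
    _ = ∫ t in (0 : ℝ)..1, ‖F' t‖ ^ 2 := by rw [sub_zero, one_mul]
    _ ≤ ‖f‖ * ‖u‖ := integral_norm_sq_le hF hF' (hweak.ae_eq_of_order_zero isOpen_Ioo) hF0 hF1
    _ ≤ ‖f‖ * ‖f‖ := mul_le_mul_of_nonneg_left h.norm_le_norm (norm_nonneg f)
    _ = ‖f‖ ^ 2 := (sq _).symm

theorem eq_zero (h : IsDirichletSol u f) (hf : f = 0) : u = 0 :=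
  norm_le_zero_iff.1 <| h.norm_le_norm.trans_eq <| by rw [hf, norm_zero]

theorem unique (hu : IsDirichletSol u f) (hv : IsDirichletSol v f) : u = v :=
  sub_eq_zero.1 ((hu.sub hv).eq_zero (sub_self f))

end IsDirichletSol

/-- The solution operator `f ↦ u` of the Dirichlet problem `u'' = f`, `u(0) = u(1) = 0`. -/
noncomputable def dirichletSol : L2I →L[ℂ] L2I :=
  LinearMap.mkContinuous
    { toFun := fun f => (IsDirichletSol.exists_sol f).choose
      map_add' := fun f g => (IsDirichletSol.exists_sol (f + g)).choose_spec.unique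
        ((IsDirichletSol.exists_sol f).choose_spec.add (IsDirichletSol.exists_sol g).choose_spec)
      map_smul' := fun c f => (IsDirichletSol.exists_sol (c • f)).choose_spec.unique
        ((IsDirichletSol.exists_sol f).choose_spec.smul c) }
    1 fun f => (IsDirichletSol.exists_sol f).choose_spec.norm_le_norm.trans_eq (one_mul _).symm

theorem isDirichletSol_dirichletSol (f : L2I) : IsDirichletSol (dirichletSol f) f :=
  (IsDirichletSol.exists_sol f).choose_spec

theorem exists_pos_le_norm {X E : Type*} [TopologicalSpace X] [NormedAddCommGroup E] {K : Set X}
    (hK : IsCompact K) {f : X → E} (hf : ContinuousOn f K) (h : ∀ x ∈ K, f x ≠ 0) :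
    ∃ δ > 0, ∀ x ∈ K, δ ≤ ‖f x‖ := by
  rcases K.eq_empty_or_nonempty with rfl | hne
  · exact ⟨1, one_pos, fun x hx => absurd hx (notMem_empty x)⟩
  · obtain ⟨x, hx, hmin⟩ := hK.exists_isMinOn hne hf.norm
    exact ⟨‖f x‖, norm_pos_iff.2 (h x hx), fun y hy => hmin hy⟩

theorem IsDirichletSol.mul_norm_sq_le_norm_add {u q : L2I} (h : IsDirichletSol u q) {a l : ℂ}
    {δ : ℝ} (hδ : ∀ θ ∈ Icc (0 : ℝ) (1 / Real.pi ^ 4), δ ≤ ‖a + l * θ‖) :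
    δ * ‖q‖ ^ 2 ≤ ‖a * (‖q‖ : ℂ) ^ 2 + l * (‖u‖ : ℂ) ^ 2‖ := by
  rcases (norm_nonneg q).eq_or_lt with hq | hq
  · rw [← hq, zero_pow two_ne_zero, mul_zero]
    exact norm_nonneg _
  · have hquot : ‖u‖ ^ 2 / ‖q‖ ^ 2 ∈ Icc (0 : ℝ) (1 / Real.pi ^ 4) := by
      refine ⟨by positivity, ?_⟩
      rw [div_le_div_iff₀ (by positivity) (by positivity), one_mul, mul_comm]
      exact h.pi_pow_four_mul_norm_sq_le
    have hq' : (‖q‖ : ℂ) ≠ 0 := by exact_mod_cast hq.ne'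
    have hfactor : a * (‖q‖ : ℂ) ^ 2 + l * (‖u‖ : ℂ) ^ 2
        = (a + l * ((‖u‖ ^ 2 / ‖q‖ ^ 2 : ℝ) : ℂ)) * (‖q‖ : ℂ) ^ 2 := by
      push_cast
      field_simp
    rw [hfactor, norm_mul, norm_pow, Complex.norm_real, norm_norm]
    gcongr
    exact hδ _ hquot

theorem exists_smul_add_smul_dirichletSol_dirichletSol_eq {a l : ℂ}
    (h : ∀ θ ∈ Icc (0 : ℝ) (1 / Real.pi ^ 4), a + l * θ ≠ 0) (g : L2I) :
    ∃ p : L2I, a • p + l • dirichletSol (dirichletSol p) = g := by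
  obtain ⟨δ, hδ, hδ_le⟩ := exists_pos_le_norm isCompact_Icc (by fun_prop) h
  let T : L2I →L[ℂ] L2I := a • 1 + l • (dirichletSol * dirichletSol)
  have hinner (p : L2I) :
      inner ℂ p (T p) = a * (‖p‖ : ℂ) ^ 2 + l * (‖dirichletSol p‖ : ℂ) ^ 2 := by
    have hsymm : inner ℂ p (dirichletSol (dirichletSol p))
        = inner ℂ (dirichletSol p) (dirichletSol p) :=
      (isDirichletSol_dirichletSol p).inner_symm (isDirichletSol_dirichletSol _)
    change inner ℂ p (a • p + l • dirichletSol (dirichletSol p)) = _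
    rw [inner_add_right, inner_smul_right, inner_smul_right, hsymm, inner_self_eq_norm_sq_to_K,
      inner_self_eq_norm_sq_to_K]
    rfl
  have hT : IsUnit T := by
    refine ContinuousLinearMap.isUnit_of_forall_le_norm_inner_map T (c := ⟨δ, hδ.le⟩) hδ fun p => ?_
    rw [norm_inner_symm, hinner, mul_comm]
    exact (isDirichletSol_dirichletSol p).mul_norm_sq_le_norm_add hδ_le
  exact (ContinuousLinearMap.isUnit_iff_bijective.1 hT).surjective g

/-! ### The energy identity -/

theorem integral_conj_mul_eq_of_hasTrace {c d : ℝ} (hcd : c < d) {u F F' q p : ℝ → ℂ}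
    (hF : IsPrimitive c d F F') (hF' : IsPrimitive c d F' q) (huF : HasWeakDeriv (Ioo c d) 0 u F)
    (hu : MemHk (Ioo c d) 4 u) (hp : HasWeakDeriv (Ioo c d) 4 u p)
    (hp_int : IntegrableOn p (Ioo c d))
    {mc md sc sd : ℂ} (hmc : HasTrace c d 2 u c mc) (hmd : HasTrace c d 2 u d md)
    (hsc : HasTrace c d 3 u c sc) (hsd : HasTrace c d 3 u d sd) :
    ∫ x in c..d, starRingEnd ℂ (F x) * p x = (∫ x in c..d, starRingEnd ℂ (q x) * q x)
      + (starRingEnd ℂ (F d) * sd - starRingEnd ℂ (F' d) * md)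
      - (starRingEnd ℂ (F c) * sc - starRingEnd ℂ (F' c) * mc) := by
  obtain ⟨A, A', hA, hA', huA, huA'⟩ :=
    hu.exists_isPrimitive_isPrimitive hcd (Nat.lt_succ_self 3) hp hp_int
  have hqA : q =ᵐ[volume.restrict (Ioo c d)] A :=
    ((huF.comp hF.hasWeakDeriv).comp hF'.hasWeakDeriv).ae_eq isOpen_Ioo huA
  have hintegral :
      ∫ x in c..d, starRingEnd ℂ (q x) * A x = ∫ x in c..d, starRingEnd ℂ (q x) * q x := by
    rw [intervalIntegral.integral_of_le hcd.le, intervalIntegral.integral_of_le hcd.le,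
      integral_Ioc_eq_integral_Ioo, integral_Ioc_eq_integral_Ioo]
    refine integral_congr_ae ?_
    filter_upwards [hqA] with x hx
    rw [hx]
  have hc := left_mem_Icc.2 hcd.le
  have hd := right_mem_Icc.2 hcd.le
  rw [hF.conj.green_identity hF'.conj hA hA', hintegral,
    hmc.eq_of_hasWeakDeriv hcd huA hA.continuousOn hc,
    hmd.eq_of_hasWeakDeriv hcd huA hA.continuousOn hd,
    hsc.eq_of_hasWeakDeriv hcd huA' hA'.continuousOn hc,
    hsd.eq_of_hasWeakDeriv hcd huA' hA'.continuousOn hd]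

namespace InBeamDomain

variable {a α ξ : ℝ} {u v q p : L2I}

theorem isDirichletSol (h : InBeamDomain a α ξ u v) (hq : HasWeakDeriv (Ioo 0 1) 2 u q) :
    IsDirichletSol u q :=
  ⟨hq, h.u_H2, h.u_zero, h.u_one⟩

theorem exists_jump (h : InBeamDomain a α ξ u v) (hξ : ξ ∈ Ioo (0 : ℝ) 1) {z : ℂ}
    (hz : HasTrace 0 1 0 v ξ z) :
    ∃ r l : ℂ, HasTrace ξ 1 3 u ξ r ∧ HasTrace 0 ξ 3 u ξ l ∧ r - l = -(α / a) * z := by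
  obtain ⟨r, l, z', hr, hl, hz', hjump⟩ := h.uxxx_jump
  rw [hz'.unique zero_lt_one hz (Ioo_subset_Icc_self hξ)] at hjump
  exact ⟨r, l, hr, hl, hjump⟩

theorem energy_identity (ha : a ≠ 0) (hξ : ξ ∈ Ioo (0 : ℝ) 1) (h : InBeamDomain a α ξ u v)
    (hq : HasWeakDeriv (Ioo 0 1) 2 u q) (hp : IsFourthDeriv ξ u p) {y z : ℂ}
    (hy : HasTrace 0 1 0 u ξ y) (hz : HasTrace 0 1 0 v ξ z) :
    a * inner ℂ u p = a * (‖q‖ : ℂ) ^ 2 + α * z * starRingEnd ℂ y := by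
  obtain ⟨F, F', hF, hF', huF, hF0, hF1⟩ := (h.isDirichletSol hq).exists_isPrimitive_isPrimitive
  have hFy : F ξ = y :=
    hy.eq_of_hasWeakDeriv zero_lt_one huF hF.continuousOn (Ioo_subset_Icc_self hξ)
  obtain ⟨m, hm_left, hm_right⟩ := h.uxx_cont
  obtain ⟨r, l, hr, hl, hjump⟩ := h.exists_jump hξ hz
  obtain ⟨s₀, hs₀⟩ := h.u_left.exists_hasTrace hξ.1 (Nat.lt_succ_self 3) 0
  obtain ⟨s₁, hs₁⟩ := h.u_right.exists_hasTrace hξ.2 (Nat.lt_succ_self 3) 1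
  have h_left := integral_conj_mul_eq_of_hasTrace hξ.1 (hF.mono le_rfl hξ.1.le hξ.2.le)
    (hF'.mono le_rfl hξ.1.le hξ.2.le) (huF.mono measurableSet_Ioo (left_subset hξ)) h.u_left hp.1
    (p.integrableOn.mono_set (left_subset hξ)) h.uxx_zero hm_left hs₀ hl
  have h_right := integral_conj_mul_eq_of_hasTrace hξ.2 (hF.mono hξ.1.le hξ.2.le le_rfl)
    (hF'.mono hξ.1.le hξ.2.le le_rfl) (huF.mono measurableSet_Ioo (right_subset hξ)) h.u_right hp.2
    (p.integrableOn.mono_set (right_subset hξ)) hm_right h.uxx_one hr hs₁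
  have hq_sq : (‖q‖ : ℂ) ^ 2 = (∫ x in (0 : ℝ)..ξ, starRingEnd ℂ (q x) * q x)
      + ∫ x in ξ..1, starRingEnd ℂ (q x) * q x :=
    (inner_self_eq_norm_sq_to_K q).symm.trans (L2I.inner_eq_integral_add_integral hξ .rfl .rfl)
  have hjump' : (a : ℂ) * (r - l) = -α * z := by
    have ha' : (a : ℂ) ≠ 0 := by exact_mod_cast ha
    rw [hjump]
    field_simp
  rw [L2I.inner_eq_integral_add_integral hξ (huF.ae_eq_of_order_zero isOpen_Ioo) .rfl, h_left,
    h_right, hq_sq, hF0, hF1, hFy]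
  simp only [map_zero, zero_mul, mul_zero, sub_zero]
  linear_combination (-starRingEnd ℂ y) * hjump'

end InBeamDomain

/-! ### The energy space and the domain of the undamped operator -/

theorem secondDeriv_spec {u : L2I} (h : MemHk (Ioo 0 1) 2 u) :
    HasWeakDeriv (Ioo 0 1) 2 u (secondDeriv u) := by
  have hex : ∃ w : L2I, HasWeakDeriv (Ioo 0 1) 2 u w := by
    obtain ⟨w, hw, hweak⟩ := h 2 le_rfl
    exact ⟨hw.toLp w, hweak.congr_right hw.coeFn_toLp.symm⟩
  rw [secondDeriv, dif_pos hex]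
  exact hex.choose_spec

theorem isDirichletSol_secondDeriv (U : energySpace) :
    IsDirichletSol U.1.1 (secondDeriv U.1.1) :=
  ⟨secondDeriv_spec U.2.1, U.2.1, U.2.2.1, U.2.2.2⟩

section EnergyNorm

variable {a : ℝ}

theorem energyNorm_sq (ha : 0 ≤ a) (U : energySpace) :
    energyNorm a U ^ 2 = a * ‖secondDeriv U.1.1‖ ^ 2 + ‖U.1.2‖ ^ 2 := by
  have hinner : energyInner a U U = ((a * ‖secondDeriv U.1.1‖ ^ 2 + ‖U.1.2‖ ^ 2 : ℝ) : ℂ) := by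
    rw [energyInner, inner_self_eq_norm_sq_to_K, inner_self_eq_norm_sq_to_K]
    push_cast
    rfl
  rw [energyNorm, hinner, Complex.ofReal_re, Real.sq_sqrt (by positivity)]

theorem norm_snd_le_energyNorm (ha : 0 ≤ a) (U : energySpace) : ‖U.1.2‖ ≤ energyNorm a U := by
  refine le_of_sq_le_sq ?_ (Real.sqrt_nonneg _)
  rw [energyNorm_sq ha]
  exact le_add_of_nonneg_left (by positivity)

theorem sqrt_mul_norm_secondDeriv_le_energyNorm (ha : 0 ≤ a) (U : energySpace) :
    √a * ‖secondDeriv U.1.1‖ ≤ energyNorm a U := by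
  refine le_of_sq_le_sq ?_ (Real.sqrt_nonneg _)
  rw [energyNorm_sq ha, mul_pow, Real.sq_sqrt ha]
  exact le_add_of_nonneg_right (by positivity)

theorem energyNorm_le_add (ha : 0 ≤ a) (U : energySpace) :
    energyNorm a U ≤ √a * ‖secondDeriv U.1.1‖ + ‖U.1.2‖ := by
  refine le_of_sq_le_sq ?_ (by positivity)
  rw [energyNorm_sq ha, add_sq, mul_pow, Real.sq_sqrt ha]
  have hcross : 0 ≤ 2 * (√a * ‖secondDeriv U.1.1‖) * ‖U.1.2‖ := by positivity
  linarith

theorem norm_fst_le_energyNorm_div_sqrt (ha : 0 < a) (U : energySpace) :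
    ‖U.1.1‖ ≤ energyNorm a U / √a := by
  rw [le_div_iff₀ (Real.sqrt_pos.2 ha), mul_comm]
  exact (mul_le_mul_of_nonneg_left (isDirichletSol_secondDeriv U).norm_le_norm
    (Real.sqrt_nonneg a)).trans (sqrt_mul_norm_secondDeriv_le_energyNorm ha.le U)

end EnergyNorm

section Undamped

variable {a ξ : ℝ} {u v q p f : L2I}

theorem inBeamDomain_of_isDirichletSol (hξ : ξ ∈ Ioo (0 : ℝ) 1) (hu : IsDirichletSol u q)
    (hq : IsDirichletSol q p) (hv : IsDirichletSol v f) : InBeamDomain a 0 ξ u v := by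
  have hH4 : MemHk (Ioo 0 1) 4 u := hu.memH2.of_hasWeakDeriv hu.weak hq.memH2
  obtain ⟨m, hm⟩ := hH4.exists_hasTrace zero_lt_one (j := 2) (by norm_num) ξ
  obtain ⟨s, hs⟩ := hH4.exists_hasTrace zero_lt_one (j := 3) (by norm_num) ξ
  obtain ⟨z, hz⟩ := hv.memH2.exists_hasTrace zero_lt_one two_pos ξ
  exact
  { u_left := hH4.mono measurableSet_Ioo (left_subset hξ)
    u_right := hH4.mono measurableSet_Ioo (right_subset hξ)
    u_H2 := hu.memH2
    v_H2 := hv.memH2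
    u_zero := hu.zero
    u_one := hu.one
    v_zero := hv.zero
    v_one := hv.one
    uxx_zero := (hq.zero.of_hasWeakDeriv hu.weak).mono le_rfl hξ.2.le
    uxx_one := (hq.one.of_hasWeakDeriv hu.weak).mono hξ.1.le le_rfl
    uxx_cont := ⟨m, hm.mono le_rfl hξ.2.le, hm.mono hξ.1.le le_rfl⟩
    uxxx_jump := ⟨s, s, z, hs.mono hξ.1.le le_rfl, hs.mono le_rfl hξ.2.le, hz, by
      rw [sub_self, Complex.ofReal_zero, zero_div, neg_zero, zero_mul]⟩ }

theorem isFourthDeriv_of_isDirichletSol (hξ : ξ ∈ Ioo (0 : ℝ) 1) (hu : IsDirichletSol u q)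
    (hq : IsDirichletSol q p) : IsFourthDeriv ξ u p :=
  ⟨(hu.weak.comp hq.weak).mono measurableSet_Ioo (left_subset hξ),
    (hu.weak.comp hq.weak).mono measurableSet_Ioo (right_subset hξ)⟩

theorem exists_beamOperator_zero_apply (b : ℝ) (hξ : ξ ∈ Ioo (0 : ℝ) 1)
    (hu : IsDirichletSol u q) (hq : IsDirichletSol q p) (hv : IsDirichletSol v f) :
    ∃ U : (beamOperator a b 0 ξ hξ).domain, U.1.1 = (u, v) ∧
      (beamOperator a b 0 ξ hξ U).1 = (v, -((a : ℂ) • p) - (b : ℂ) • v) := by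
  let U : beamDomain a 0 ξ hξ :=
    ⟨⟨(u, v), hu.memH2, hu.zero, hu.one⟩, inBeamDomain_of_isDirichletSol hξ hu hq hv⟩
  have hp : fourthDeriv hξ U = p :=
    (fourthDeriv_spec hξ U).unique (isFourthDeriv_of_isDirichletSol hξ hu hq)
  refine ⟨U, rfl, Prod.ext rfl ((beamOperator_snd a b 0 ξ hξ U).trans ?_)⟩
  rw [hp]

end Undamped

theorem exists_ne_zero_isDirichletSol_smul {n : ℕ} (hn : n ≠ 0) :
    ∃ u : L2I, u ≠ 0 ∧ IsDirichletSol u ((-(n * Real.pi : ℂ) ^ 2) • u) := by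
  set k : ℝ := n * Real.pi
  have hlin (x : ℝ) : HasDerivAt (fun y : ℝ => k * y) k x := by
    simpa only [id, mul_one] using (hasDerivAt_id x).const_mul k
  have hsin : IsPrimitive 0 1 (fun x => ((Real.sin (k * x) : ℝ) : ℂ))
      (fun x => ((Real.cos (k * x) * k : ℝ) : ℂ)) :=
    .of_hasDerivAt zero_le_one (fun x => (hlin x).sin.ofReal_comp) (by fun_prop)
  have hcos : IsPrimitive 0 1 (fun x => ((Real.cos (k * x) * k : ℝ) : ℂ))
      (fun x => ((-Real.sin (k * x) * k * k : ℝ) : ℂ)) :=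
    .of_hasDerivAt zero_le_one (fun x => ((hlin x).cos.mul_const k).ofReal_comp) (by fun_prop)
  have hmem := memLp_restrict_Ioo_of_continuousOn hsin.continuousOn 2
  refine ⟨hmem.toLp _, fun hzero => ?_, .of_isPrimitive hsin (hcos.congr_ae ?_) (by simp)
    (by simp [k, Real.sin_nat_mul_pi]) hmem.coeFn_toLp⟩
  · have hsin_ae := hmem.coeFn_toLp.symm.trans (hzero ▸ (L2I.coe_zero le_rfl).symm)
    have hn_pos : (0 : ℝ) < n := by positivity
    have hpeak : (1 / (2 * n) : ℝ) ∈ Icc (0 : ℝ) 1 := by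
      have hn_one : (1 : ℝ) ≤ n := by exact_mod_cast Nat.one_le_iff_ne_zero.2 hn
      exact ⟨by positivity, (div_le_one (by positivity)).2 (by linarith)⟩
    have hsin_peak := eqOn_Icc_of_ae_eq zero_lt_one hsin.continuousOn continuousOn_const hsin_ae
      hpeak
    have harg : k * (1 / (2 * n)) = Real.pi / 2 := by
      simp only [k]
      field_simp
    simp only [harg, Real.sin_pi_div_two, Complex.ofReal_one] at hsin_peak
    exact one_ne_zero hsin_peak
  · filter_upwards [hmem.coeFn_toLp,
      L2I.coe_smul le_rfl (-(n * Real.pi : ℂ) ^ 2) (hmem.toLp _)] with x hx hx_smul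
    rw [← hx_smul, hx]
    simp only [k]
    push_cast
    ring

theorem IsEigenvalue.mem_spectrumOf {a : ℝ} {T : energySpace →ₗ.[ℂ] energySpace} {μ : ℂ}
    (h : IsEigenvalue T μ) : μ ∈ spectrumOf a T := by
  obtain ⟨U, hU, hT⟩ := h
  refine fun hres => hU (hres.1.injective ?_)
  simp only [hT, sub_self, ZeroMemClass.coe_zero, smul_zero, LinearPMap.map_zero]

/-! ### The resolvent of the undamped operator -/

section Resolvent

variable {a b α ξ : ℝ} {hξ : ξ ∈ Ioo (0 : ℝ) 1} {μ : ℂ}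

theorem isEigenvalue_beamOperator_zero {n : ℕ} (hn : n ≠ 0)
    (hμ : μ ^ 2 + b * μ + a * (n * Real.pi : ℂ) ^ 4 = 0) :
    IsEigenvalue (beamOperator a b 0 ξ hξ) μ := by
  obtain ⟨u, hu_ne, hu⟩ := exists_ne_zero_isDirichletSol_smul hn
  obtain ⟨U, hU, hAU⟩ :=
    exists_beamOperator_zero_apply (a := a) b hξ hu (hu.smul _) (hu.smul μ)
  refine ⟨U, fun hzero => hu_ne ?_, Subtype.ext ?_⟩
  · simpa [hzero] using (congrArg Prod.fst hU).symm
  · rw [hAU, Submodule.coe_smul, hU]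
    refine Prod.ext rfl ?_
    change -((a : ℂ) • _ • _ • u) - (b : ℂ) • μ • u = μ • μ • u
    linear_combination (norm := module) (-hμ) • u

theorem inner_fst_eq_of_smul_sub_beamOperator_eq (ha : a ≠ 0)
    {U : (beamOperator a b α ξ hξ).domain} {F : energySpace}
    (hF : μ • (U : energySpace) - beamOperator a b α ξ hξ U = F) {y z : ℂ}
    (hy : HasTrace 0 1 0 U.1.1.1 ξ y) (hz : HasTrace 0 1 0 U.1.1.2 ξ z) :
    inner ℂ U.1.1.1 (F.1.2 + (μ + b) • F.1.1) = a * (‖secondDeriv U.1.1.1‖ : ℂ) ^ 2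
      + α * z * starRingEnd ℂ y + μ * (μ + b) * (‖U.1.1.1‖ : ℂ) ^ 2 := by
  have hU : InBeamDomain a α ξ U.1.1.1 U.1.1.2 := U.2
  have hfst : μ • U.1.1.1 - U.1.1.2 = F.1.1 := congrArg (fun W : energySpace => W.1.1) hF
  have hsnd : μ • U.1.1.2 - (-((a : ℂ) • fourthDeriv hξ U) - (b : ℂ) • U.1.1.2) = F.1.2 :=
    congrArg (fun W : energySpace => W.1.2) hF
  have helim : F.1.2 + (μ + b) • F.1.1
      = (a : ℂ) • fourthDeriv hξ U + (μ * (μ + b)) • U.1.1.1 := by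
    rw [← hfst, ← hsnd]
    module
  rw [helim, inner_add_right, inner_smul_right, inner_smul_right,
    hU.energy_identity ha hξ (secondDeriv_spec hU.u_H2) (fourthDeriv_spec hξ U) hy hz,
    inner_self_eq_norm_sq_to_K]
  rfl

theorem mul_norm_secondDeriv_le (ha : a ≠ 0) {δ : ℝ}
    (hδ : ∀ θ ∈ Icc (0 : ℝ) (1 / Real.pi ^ 4), δ ≤ ‖(a : ℂ) + μ * (μ + b) * θ‖)
    {U : (beamOperator a b 0 ξ hξ).domain} {F : energySpace}
    (hF : μ • (U : energySpace) - beamOperator a b 0 ξ hξ U = F) :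
    δ * ‖secondDeriv U.1.1.1‖ ≤ ‖F.1.2 + (μ + b) • F.1.1‖ := by
  have hU : InBeamDomain a 0 ξ U.1.1.1 U.1.1.2 := U.2
  have hq := isDirichletSol_secondDeriv U.1
  obtain ⟨y, hy⟩ := hU.u_H2.exists_hasTrace zero_lt_one two_pos ξ
  obtain ⟨z, hz⟩ := hU.v_H2.exists_hasTrace zero_lt_one two_pos ξ
  have hinner := inner_fst_eq_of_smul_sub_beamOperator_eq ha hF hy hz
  rw [Complex.ofReal_zero, zero_mul, zero_mul, add_zero] at hinner
  rcases (norm_nonneg (secondDeriv U.1.1.1)).eq_or_lt with hzero | hpos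
  · rw [← hzero, mul_zero]
    exact norm_nonneg _
  · refine le_of_mul_le_mul_right ?_ hpos
    calc δ * ‖secondDeriv U.1.1.1‖ * ‖secondDeriv U.1.1.1‖
        = δ * ‖secondDeriv U.1.1.1‖ ^ 2 := by ring
      _ ≤ ‖inner ℂ U.1.1.1 (F.1.2 + (μ + b) • F.1.1)‖ := hinner ▸ hq.mul_norm_sq_le_norm_add hδ
      _ ≤ ‖U.1.1.1‖ * ‖F.1.2 + (μ + b) • F.1.1‖ := norm_inner_le_norm _ _
      _ ≤ ‖secondDeriv U.1.1.1‖ * ‖F.1.2 + (μ + b) • F.1.1‖ := by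
        gcongr
        exact hq.norm_le_norm
      _ = ‖F.1.2 + (μ + b) • F.1.1‖ * ‖secondDeriv U.1.1.1‖ := mul_comm _ _

theorem exists_energyNorm_le_mul (ha : 0 < a)
    (h : ∀ θ ∈ Icc (0 : ℝ) (1 / Real.pi ^ 4), (a : ℂ) + μ * (μ + b) * θ ≠ 0) :
    ∃ C : ℝ, ∀ U : (beamOperator a b 0 ξ hξ).domain,
      energyNorm a U ≤ C * energyNorm a (μ • (U : energySpace) - beamOperator a b 0 ξ hξ U) := by
  obtain ⟨δ, hδ, hδ_le⟩ := exists_pos_le_norm isCompact_Icc (by fun_prop) h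
  set K : ℝ := (1 + ‖μ + b‖ / √a) / δ with hK
  refine ⟨√a * K + (‖μ‖ * K + 1 / √a), fun U => ?_⟩
  set F := μ • (U : energySpace) - beamOperator a b 0 ξ hξ U with hF
  have hF_fst := norm_fst_le_energyNorm_div_sqrt ha F
  have hq : ‖secondDeriv U.1.1.1‖ ≤ K * energyNorm a F := by
    rw [hK, div_mul_eq_mul_div, le_div_iff₀ hδ, mul_comm]
    calc δ * ‖secondDeriv U.1.1.1‖ ≤ ‖F.1.2 + (μ + b) • F.1.1‖ :=
          mul_norm_secondDeriv_le ha.ne' hδ_le hF.symm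
      _ ≤ ‖F.1.2‖ + ‖μ + b‖ * ‖F.1.1‖ := norm_add_le_of_le le_rfl (norm_smul_le _ _)
      _ ≤ energyNorm a F + ‖μ + b‖ * (energyNorm a F / √a) := by
        gcongr
        exact norm_snd_le_energyNorm ha.le F
      _ = (1 + ‖μ + b‖ / √a) * energyNorm a F := by ring
  have hv_eq : U.1.1.2 = μ • U.1.1.1 - F.1.1 := (sub_sub_cancel (μ • U.1.1.1) U.1.1.2).symm
  have hv : ‖U.1.1.2‖ ≤ ‖μ‖ * (K * energyNorm a F) + energyNorm a F / √a := by
    rw [hv_eq]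
    refine norm_sub_le_of_le ((norm_smul_le _ _).trans ?_) hF_fst
    gcongr
    exact (isDirichletSol_secondDeriv U.1).norm_le_norm.trans hq
  calc energyNorm a U ≤ √a * ‖secondDeriv U.1.1.1‖ + ‖U.1.1.2‖ := energyNorm_le_add ha.le U.1
    _ ≤ √a * (K * energyNorm a F) + (‖μ‖ * (K * energyNorm a F) + energyNorm a F / √a) := by
      gcongr
    _ = (√a * K + (‖μ‖ * K + 1 / √a)) * energyNorm a F := by ring

theorem surjective_smul_sub_beamOperator
    (h : ∀ θ ∈ Icc (0 : ℝ) (1 / Real.pi ^ 4), (a : ℂ) + μ * (μ + b) * θ ≠ 0) :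
    Function.Surjective fun U : (beamOperator a b 0 ξ hξ).domain =>
      μ • (U : energySpace) - beamOperator a b 0 ξ hξ U := by
  intro F
  obtain ⟨p, hp⟩ :=
    exists_smul_add_smul_dirichletSol_dirichletSol_eq h (F.1.2 + (μ + b) • F.1.1)
  have hq := isDirichletSol_dirichletSol p
  have hu := isDirichletSol_dirichletSol (dirichletSol p)
  obtain ⟨U, hU, hAU⟩ := exists_beamOperator_zero_apply (a := a) b hξ hu hq
    ((hu.smul μ).sub (isDirichletSol_secondDeriv F))
  refine ⟨U, Subtype.ext ?_⟩
  rw [Submodule.coe_sub, Submodule.coe_smul, hU, hAU]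
  set u := dirichletSol (dirichletSol p)
  refine Prod.ext (sub_sub_cancel (μ • u) F.1.1) ?_
  change μ • (μ • u - F.1.1) - (-((a : ℂ) • p) - (b : ℂ) • (μ • u - F.1.1)) = F.1.2
  linear_combination (norm := module) hp

theorem injective_smul_sub_beamOperator (ha : a ≠ 0)
    (h : ∀ θ ∈ Icc (0 : ℝ) (1 / Real.pi ^ 4), (a : ℂ) + μ * (μ + b) * θ ≠ 0) :
    Function.Injective fun U : (beamOperator a b 0 ξ hξ).domain =>
      μ • (U : energySpace) - beamOperator a b 0 ξ hξ U := by
  obtain ⟨δ, hδ, hδ_le⟩ := exists_pos_le_norm isCompact_Icc (by fun_prop) h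
  intro U V hUV
  have hker : μ • ((U - V : (beamOperator a b 0 ξ hξ).domain) : energySpace)
      - beamOperator a b 0 ξ hξ (U - V) = 0 := by
    rw [LinearPMap.map_sub, Submodule.coe_sub, smul_sub, sub_sub_sub_comm]
    exact sub_eq_zero.2 hUV
  have hq : δ * ‖secondDeriv (U - V).1.1.1‖ ≤ 0 := by
    simpa using mul_norm_secondDeriv_le ha hδ_le hker
  have hu : (U - V).1.1.1 = 0 := (isDirichletSol_secondDeriv (U - V).1).eq_zero <|
    norm_le_zero_iff.1 (nonpos_of_mul_nonpos_right hq hδ)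
  have hfst : μ • (U - V).1.1.1 - (U - V).1.1.2 = 0 :=
    congrArg (fun W : energySpace => W.1.1) hker
  have hv : (U - V).1.1.2 = 0 := by
    rw [← sub_eq_zero.1 hfst, hu, smul_zero]
  exact sub_eq_zero.1 (Subtype.ext (Subtype.ext (Prod.ext hu hv)))

theorem mem_resolventSetOf_beamOperator_zero (ha : 0 < a)
    (h : ∀ θ ∈ Icc (0 : ℝ) (1 / Real.pi ^ 4), (a : ℂ) + μ * (μ + b) * θ ≠ 0) :
    μ ∈ resolventSetOf a (beamOperator a b 0 ξ hξ) :=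
  ⟨⟨injective_smul_sub_beamOperator ha.ne' h, surjective_smul_sub_beamOperator h⟩,
    exists_energyNorm_le_mul ha h⟩

end Resolvent

/-! ### Location of the eigenvalues -/

/-- The largest real part of a complex root of `x ^ 2 + b * x + c`. Since `√` vanishes on negative
numbers, the formula also covers nonreal roots, whose real part is `-b / 2`. -/
noncomputable def rootAbscissa (b c : ℝ) : ℝ := (-b + √(b ^ 2 - 4 * c)) / 2

section RootAbscissa

variable {b c : ℝ}

theorem rootAbscissa_eq_neg_div_two (h : b ^ 2 ≤ 4 * c) : rootAbscissa b c = -b / 2 := by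
  rw [rootAbscissa, Real.sqrt_eq_zero_of_nonpos (sub_nonpos.2 h), add_zero]

theorem neg_div_two_le_rootAbscissa (b c : ℝ) : -b / 2 ≤ rootAbscissa b c := by
  have hsqrt := Real.sqrt_nonneg (b ^ 2 - 4 * c)
  rw [rootAbscissa]
  linarith

theorem sq_sub_rootAbscissa_le {x : ℝ} (hx : rootAbscissa b c ≤ x) :
    (x - rootAbscissa b c) ^ 2 ≤ x ^ 2 + b * x + c := by
  have hroot : √(b ^ 2 - 4 * c) = 2 * rootAbscissa b c + b := by
    rw [rootAbscissa]
    ring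
  have hdiscr : b ^ 2 - 4 * c ≤ √(b ^ 2 - 4 * c) ^ 2 := (Real.sqrt_le_iff.1 le_rfl).2
  have hmul : 0 ≤ (x - rootAbscissa b c) * √(b ^ 2 - 4 * c) :=
    mul_nonneg (sub_nonneg.2 hx) (Real.sqrt_nonneg _)
  rw [hroot] at hdiscr hmul
  linarith

theorem exists_root_re_eq_rootAbscissa (b c : ℝ) :
    ∃ μ : ℂ, μ ^ 2 + b * μ + c = 0 ∧ μ.re = rootAbscissa b c := by
  rcases le_total (b ^ 2) (4 * c) with h | h
  · have hsq : ((√(c - b ^ 2 / 4) : ℝ) : ℂ) ^ 2 = c - b ^ 2 / 4 := by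
      exact_mod_cast congrArg Complex.ofReal (Real.sq_sqrt (by linarith : 0 ≤ c - b ^ 2 / 4))
    refine ⟨((-b / 2 : ℝ) : ℂ) + (√(c - b ^ 2 / 4) : ℝ) * Complex.I, ?_, ?_⟩
    · push_cast
      linear_combination ((√(c - b ^ 2 / 4) : ℝ) : ℂ) ^ 2 * Complex.I_sq - hsq
    · rw [rootAbscissa_eq_neg_div_two h, Complex.add_re, Complex.ofReal_re,
        Complex.re_ofReal_mul, Complex.I_re, mul_zero, add_zero]
  · refine ⟨rootAbscissa b c, ?_, Complex.ofReal_re _⟩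
    have hsq := Real.sq_sqrt (sub_nonneg.2 h)
    have hroot : rootAbscissa b c ^ 2 + b * rootAbscissa b c + c = 0 := by
      rw [rootAbscissa]
      linarith
    exact_mod_cast congrArg Complex.ofReal hroot

theorem im_eq_zero_of_energy_balance {a α N Q s : ℝ} {μ : ℂ} (hα : 0 ≤ α) (hN : 0 < N)
    (hs : 0 ≤ s) (hμ : -b / 2 < μ.re)
    (h : (a : ℂ) * Q + α * μ * s + μ * (μ + b) * N = 0) : μ.im = 0 := by
  have him := congrArg Complex.im h
  simp only [Complex.add_re, Complex.mul_re, Complex.ofReal_re, Complex.add_im, Complex.mul_im,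
    Complex.ofReal_im, Complex.zero_im] at him
  have hfactor : μ.im * (α * s + (2 * μ.re + b) * N) = 0 := by linarith
  have hpos : 0 < α * s + (2 * μ.re + b) * N :=
    add_pos_of_nonneg_of_pos (mul_nonneg hα hs) (mul_pos (by linarith) hN)
  exact (mul_eq_zero.1 hfactor).resolve_right hpos.ne'

theorem re_le_rootAbscissa_add_of_energy_balance {a α ε N Q s : ℝ} {μ : ℂ} (hε : 0 < ε)
    (hα : 0 ≤ α) (hαa : α * |b| ≤ a) (hαε : α * |b| * c < ε ^ 2) (hN : 0 < N)
    (hNQ : c * N ≤ Q) (hs : 0 ≤ s) (hsQ : s ≤ Q)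
    (h : (a : ℂ) * Q + α * μ * s + μ * (μ + b) * N = 0) :
    μ.re ≤ rootAbscissa b (a * c) + ε := by
  by_contra! hlt
  have hre_gt : -b / 2 < μ.re := by linarith [neg_div_two_le_rootAbscissa b (a * c)]
  have hre := congrArg Complex.re h
  simp only [Complex.add_re, Complex.mul_re, Complex.ofReal_re, Complex.add_im, Complex.mul_im,
    Complex.ofReal_im, Complex.zero_re, im_eq_zero_of_energy_balance hα hN hs hre_gt h] at hre
  -- `-|b| ≤ re μ`, so a negative damping term is absorbed by the stiffness term.
  have hdamping : -(α * |b| * Q) ≤ α * μ.re * s := by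
    have hshift : 0 ≤ α * s * (μ.re + |b|) :=
      mul_nonneg (mul_nonneg hα hs) (by linarith [le_abs_self b, abs_nonneg b])
    have hgap : 0 ≤ α * |b| * (Q - s) :=
      mul_nonneg (mul_nonneg hα (abs_nonneg b)) (sub_nonneg.2 hsQ)
    linarith
  have hstiffness : (a - α * |b|) * (c * N) ≤ (a - α * |b|) * Q :=
    mul_le_mul_of_nonneg_left hNQ (sub_nonneg.2 hαa)
  have hquadratic : ε ^ 2 ≤ μ.re ^ 2 + b * μ.re + a * c :=
    (pow_le_pow_left₀ hε.le (by linarith) 2).trans (sq_sub_rootAbscissa_le (by linarith))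
  have hcontra : 0 < (μ.re ^ 2 + b * μ.re + a * c - α * |b| * c) * N :=
    mul_pos (by linarith) hN
  linarith

theorem add_mul_mul_ne_zero_of_rootAbscissa_lt {a : ℝ} {μ : ℂ} (ha : 0 < a) (hc : 0 < c)
    (hμ : rootAbscissa b (a * c) < μ.re) :
    ∀ θ ∈ Icc (0 : ℝ) (1 / c), (a : ℂ) + μ * (μ + b) * θ ≠ 0 := by
  rintro θ ⟨hθ_nonneg, hθ_le⟩ hzero
  have hθ : 0 < θ := by
    refine hθ_nonneg.lt_of_ne' fun hθ_zero => ha.ne' ?_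
    rw [hθ_zero, Complex.ofReal_zero, mul_zero, add_zero] at hzero
    exact_mod_cast hzero
  refine hμ.not_ge (le_of_forall_pos_le_add fun ε hε => ?_)
  refine re_le_rootAbscissa_add_of_energy_balance (α := 0) (Q := 1) (s := 0) hε le_rfl ?_ ?_ hθ
    ((le_div_iff₀' hc).1 hθ_le) le_rfl zero_le_one ?_
  · rw [zero_mul]
    exact ha.le
  · rw [zero_mul, zero_mul]
    positivity
  · simpa using hzero

end RootAbscissa

section BeamSpectrum

variable {a b α ξ : ℝ} {hξ : ξ ∈ Ioo (0 : ℝ) 1} {μ : ℂ}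

theorem IsEigenvalue.exists_energy_balance (ha : a ≠ 0)
    (h : IsEigenvalue (beamOperator a b α ξ hξ) μ) :
    ∃ N Q s : ℝ, 0 < N ∧ Real.pi ^ 4 * N ≤ Q ∧ 0 ≤ s ∧ s ≤ Q ∧
      (a : ℂ) * Q + α * μ * s + μ * (μ + b) * N = 0 := by
  obtain ⟨U, hU_ne, hT⟩ := h
  have hU : InBeamDomain a α ξ U.1.1.1 U.1.1.2 := U.2
  have hq := isDirichletSol_secondDeriv U.1
  have hv : U.1.1.2 = μ • U.1.1.1 := congrArg (fun W : energySpace => W.1.1) hT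
  have hu_ne : U.1.1.1 ≠ 0 := fun hu =>
    hU_ne (Subtype.ext (Subtype.ext (Prod.ext hu (by rw [hv, hu, smul_zero]; rfl))))
  obtain ⟨y, hy⟩ := hU.u_H2.exists_hasTrace zero_lt_one two_pos ξ
  have hz : HasTrace 0 1 0 U.1.1.2 ξ (μ * y) := by
    rw [hv]
    exact (hy.smul μ).congr (L2I.coe_smul le_rfl _ _)
  have hbalance := inner_fst_eq_of_smul_sub_beamOperator_eq ha (sub_eq_zero.2 hT.symm) hy hz
  have hzero : inner ℂ U.1.1.1 ((0 : energySpace).1.2 + (μ + b) • (0 : energySpace).1.1) = 0 := by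
    simp
  have hconj : y * starRingEnd ℂ y = (‖y‖ : ℂ) ^ 2 := Complex.mul_conj' y
  refine ⟨‖U.1.1.1‖ ^ 2, ‖secondDeriv U.1.1.1‖ ^ 2, ‖y‖ ^ 2, by positivity,
    hq.pi_pow_four_mul_norm_sq_le, by positivity, ?_, ?_⟩
  · exact pow_le_pow_left₀ (norm_nonneg y) (hq.norm_trace_le (Ioo_subset_Icc_self hξ) hy) 2
  · push_cast
    linear_combination hzero - hbalance - α * μ * hconj

theorem isLUB_re_spectrumOf_beamOperator_zero (ha : 0 < a) :
    IsLUB (Complex.re '' spectrumOf a (beamOperator a b 0 ξ hξ))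
      (rootAbscissa b (a * Real.pi ^ 4)) := by
  constructor
  · rintro _ ⟨μ, hμ, rfl⟩
    by_contra! hlt
    exact hμ (mem_resolventSetOf_beamOperator_zero ha
      (add_mul_mul_ne_zero_of_rootAbscissa_lt ha (by positivity) hlt))
  · intro s hs
    obtain ⟨μ, hroot, hre⟩ := exists_root_re_eq_rootAbscissa b (a * Real.pi ^ 4)
    have hμ : IsEigenvalue (beamOperator a b 0 ξ hξ) μ :=
      isEigenvalue_beamOperator_zero one_ne_zero (by simpa using hroot)
    exact hs ⟨μ, hμ.mem_spectrumOf, hre⟩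

theorem exists_forall_re_le_of_isEigenvalue (b : ℝ) (hξ : ξ ∈ Ioo (0 : ℝ) 1) (ha : 0 < a)
    {ε : ℝ} (hε : 0 < ε) :
    ∃ α₀ : ℝ, 0 < α₀ ∧ ∀ α : ℝ, 0 < α → α < α₀ →
      ∀ μ : ℂ, IsEigenvalue (beamOperator a b α ξ hξ) μ →
        μ.re ≤ rootAbscissa b (a * Real.pi ^ 4) + ε := by
  have hb : |b| ≤ |b| + 1 := by linarith
  refine ⟨min (a / (|b| + 1)) (ε ^ 2 / ((|b| + 1) * Real.pi ^ 4)), by positivity,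
    fun α hα hlt μ hμ => ?_⟩
  obtain ⟨N, Q, s, hN, hNQ, hs, hsQ, hbalance⟩ := hμ.exists_energy_balance ha.ne'
  have hαa : α * (|b| + 1) < a :=
    (lt_div_iff₀ (by positivity)).1 (hlt.trans_le (min_le_left _ _))
  have hαε : α * ((|b| + 1) * Real.pi ^ 4) < ε ^ 2 :=
    (lt_div_iff₀ (by positivity)).1 (hlt.trans_le (min_le_right _ _))
  refine re_le_rootAbscissa_add_of_energy_balance hε hα.le ?_ ?_ hN hNQ hs hsQ hbalance
  · exact (by gcongr : α * |b| ≤ α * (|b| + 1)).trans hαa.le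
  · rw [mul_assoc]
    exact (by gcongr : α * (|b| * Real.pi ^ 4) ≤ α * ((|b| + 1) * Real.pi ^ 4)).trans_lt hαε

end BeamSpectrum

theorem mainTheorem3_general (a b ξ : ℝ) (ha : 0 < a) (hξ : ξ ∈ Set.Ioo (0 : ℝ) 1) :
    (|b| ≤ 2 * Real.sqrt a * Real.pi ^ 2 →
      IsLUB (Complex.re '' spectrumOf a (beamOperator a b 0 ξ hξ)) (-b / 2)) ∧
    (2 * Real.sqrt a * Real.pi ^ 2 < |b| →
      IsLUB (Complex.re '' spectrumOf a (beamOperator a b 0 ξ hξ))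
        ((-b + Real.sqrt (b ^ 2 - 4 * a * Real.pi ^ 4)) / 2)) ∧
    (∀ ε : ℝ, 0 < ε → ∃ α₀ : ℝ, 0 < α₀ ∧ ∀ α : ℝ, 0 < α → α < α₀ →
      ∀ μ : ℂ, IsEigenvalue (beamOperator a b α ξ hξ) μ →
        (|b| ≤ 2 * Real.sqrt a * Real.pi ^ 2 → μ.re ≤ -b / 2 + ε) ∧
        (2 * Real.sqrt a * Real.pi ^ 2 < |b| →
          μ.re ≤ (-b + Real.sqrt (b ^ 2 - 4 * a * Real.pi ^ 4)) / 2 + ε)) := by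
  have hreal : (-b + √(b ^ 2 - 4 * a * Real.pi ^ 4)) / 2 = rootAbscissa b (a * Real.pi ^ 4) := by
    rw [rootAbscissa, mul_assoc]
  have hnonreal (h : |b| ≤ 2 * √a * Real.pi ^ 2) :
      -b / 2 = rootAbscissa b (a * Real.pi ^ 4) := by
    refine (rootAbscissa_eq_neg_div_two ?_).symm
    calc b ^ 2 ≤ (2 * √a * Real.pi ^ 2) ^ 2 := sq_le_sq.2 (h.trans (le_abs_self _))
      _ = 4 * (√a ^ 2 * Real.pi ^ 4) := by ring
      _ = 4 * (a * Real.pi ^ 4) := by rw [Real.sq_sqrt ha.le]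
  have hLUB := isLUB_re_spectrumOf_beamOperator_zero (b := b) (hξ := hξ) ha
  rw [hreal]
  refine ⟨fun h => hnonreal h ▸ hLUB, fun _ => hLUB, fun ε hε => ?_⟩
  obtain ⟨α₀, hα₀, hre_le⟩ := exists_forall_re_le_of_isEigenvalue b hξ ha hε
  exact ⟨α₀, hα₀, fun α hα hα_lt μ hμ =>
    ⟨fun h => hnonreal h ▸ hre_le α hα hα_lt μ hμ, fun _ => hre_le α hα hα_lt μ hμ⟩⟩

theorem mainTheorem3 (a b ξ : ℝ) (ha : 0 < a) (hb : 0 < b) (hξ : ξ ∈ Set.Ioo (0 : ℝ) 1)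
    (hirr : Irrational ξ) :
    (b ≤ 2 * Real.sqrt a * Real.pi ^ 2 →
      IsLUB (Complex.re '' spectrumOf a (beamOperator a b 0 ξ hξ)) (-b / 2)) ∧
    (2 * Real.sqrt a * Real.pi ^ 2 < b →
      IsLUB (Complex.re '' spectrumOf a (beamOperator a b 0 ξ hξ))
        ((-b + Real.sqrt (b ^ 2 - 4 * a * Real.pi ^ 4)) / 2)) ∧
    (∀ ε : ℝ, 0 < ε → ∃ α₀ : ℝ, 0 < α₀ ∧ ∀ α : ℝ, 0 < α → α < α₀ →
      ∀ μ : ℂ, IsEigenvalue (beamOperator a b α ξ hξ) μ →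
        (b ≤ 2 * Real.sqrt a * Real.pi ^ 2 → μ.re ≤ -b / 2 + ε) ∧
        (2 * Real.sqrt a * Real.pi ^ 2 < b →
          μ.re ≤ (-b + Real.sqrt (b ^ 2 - 4 * a * Real.pi ^ 4)) / 2 + ε)) := by
  simpa only [abs_of_pos hb] using mainTheorem3_general a b ξ ha hξ
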